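/- **Setting.** Let $\tilde H$ be a connected real Lie group acting smoothly, transitively and effectively on a manifold $\tilde M=\tilde H/\tilde K$ of dimension $\tilde n=n+m$, where $\tilde K$ is the stabilizer of a point $o$. Let $u_o$ be a linear frame at $o$, $\tilde P=\tilde H\cdot u_o$ the associated homogeneous $\tilde G$-structure, and $\tilde G\subset \mathrm{GL}_{\tilde n}(\mathbb R)$ the image of the isotropy representation of $\tilde K$ in the frame $u_o$. Assume that $(\tilde H/\tilde K,\tilde P)$ is *flat $k$-reductive*: $\tilde{\mathfrak h}=\mathrm{Lie}(\tilde H)=\bigoplus_{p=-1}^{k-1}\tilde{\mathfrak h}^p$ with $[\tilde{\mathfrak h}^r,\tilde{\mathfrak h}^s]\subset\tilde{\mathfrak h}^{r+s}$ (where $\tilde{\mathfrak h}^p=0$ for $p\notin\{-1,\dots,k-1\}$) and $\mathrm{Lie}(\tilde K)=\bigoplus_{p\ge 0}\tilde{\mathfrak h}^p$. Identify $\tilde{\mathfrak h}^{-1}\simeq\tilde{\mathfrak h}/\mathrm{Lie}(\tilde K)\simeq T_o\tilde M\simeq V=\mathbb R^{\tilde n}$ by $u_o$, and let $W\simeq\mathbb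 R^n$ be the subspace of $V$ where the last $m$ coordinates vanish. Let $G_\sharp=\{\begin{pmatrix}A&B\\0&D\end{pmatrix}\in\tilde G\}$ and $N_\sharp=\{\begin{pmatrix}I&B\\0&D\end{pmatrix}\in\tilde G\}$, with $A$ and $I$ of size $n\times n$. Let $P\to M$ be a $G$-structure on an $n$-dimensional manifold with soldering form $\vartheta=(\vartheta^1,\dots,\vartheta^n)$, where $G\subset\mathrm{GL}_n(\mathbb R)$ is closed and isomorphic to $G_\sharp/N_\sharp$. **Admissible tuples and curvature.** Let $p\ge 0$. An *admissible tuple* $(s,\omega^0,\dots,\omega^{p-1})$ on an open set $\mathcal U\subset M$ consists of a smooth section $s$ of $P$ over $\mathcal U$ and smooth $1$-forms $\omega^r$ on $\mathcal U$ with values in $\tilde{\mathfrak h}^r$ such that, with $\omega^{-1}=(s^*\vartheta^1,\dots,s^*\vartheta^n,0,\dots,0)$ and $$\Omega^{q-1}=d\omega^{q-1}+\tfrac12\sum_{r=0}^{q-1}[\omega^r,\omega^{q-1-r}]+\tfrac12[\omega^{-1},\omega^{-1}]^{\tilde{\mathfrak h}^{q-1}},$$ one has $\Omega^{q-1}=-[\omega^{-1},\omega^{q}]$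 for $0\le q\le p-1$; here $(\cdot)^{\tilde{\mathfrak h}^{q-1}}$ is the projection to $\tilde{\mathfrak h}^{q-1}$ and $[\alpha,\beta](v,w)=[\alpha(v),\beta(w)]-[\alpha(w),\beta(v)]$. Its *total $(G,\tilde G)$-curvature* (of order $p+1$) is $\Omega^{p-1}$. $P$ is *locally immersible in $\tilde P$ to order $p$* if every point of $M$ lies in the domain of such a tuple. **Cohomology.** Let $\mathfrak c_r^{p-1}\subset\tilde{\mathfrak h}^{p-1}$ be the space of all $X$ with $[\dots[[X,w_1],w_2]\dots,w_r]=0$ for all $w_i\in W$ (so $\mathfrak c_0^{p-1}=0$). Put $C_r^{0,q}=V\otimes\Lambda^qW^*$ and $C_r^{p,q}=(\tilde{\mathfrak h}^{p-1}/\mathfrak c_r^{p-1})\otimes\Lambda^qW^*$ for $p\ge1$. For $r\le p$, the generalized Spencer operator $\partial:C_r^{p,q}\to C_r^{p-1,q+1}$ (where $C_r^{-1,q+1}=0$) is $$\partial c(w_1,\dots,w_{q+1})=\sum_{i=1}^{q+1}(-1)^i\,[c(w_1,\dots,\widehat{w_i},\dots,w_{q+1}),w_i],$$ taken modulo $\mathfrak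 c_r^{p-2}$ if $p\ge2$. Write $C^{p,q}(\tilde{\mathfrak h},W)=C_0^{p,q}$ and $H^{p,q}(\tilde{\mathfrak h},W)$ for the cohomology at $C_0^{p,q}$ (the kernel of $\partial$ on $C_0^{p,q}$ modulo $\partial C_0^{p+1,q-1}$). **Theorem 3.4.** Let $p\ge0$ and assume that $P$ is locally immersible in $\tilde P$ to order $p$. For an admissible tuple $(s,\omega^0,\dots,\omega^{p-1})$ on $\mathcal U$, identify $T_xM$, $x\in\mathcal U$, with $W$ by the frame $s_x$, so that $\Omega^{p-1}|_x\in C^{p,2}(\tilde{\mathfrak h},W)$, and let $\hat\Omega_r^{p-1}|_x\in C_r^{p,2}$ be its projection modulo $\mathfrak c_r^{p-1}$. Then: (i) for every admissible tuple $(s,\omega^0,\dots,\omega^{p-1})$ on any open $\mathcal U$ and every $x\in\mathcal U$, $\partial(\Omega^{p-1}|_x)=0$, and $\partial(\hat\Omega^{p-1}_r|_x)=0$ for all $1\le r\le p$; (ii) $P$ is locally immersible in $\tilde P$ to order $p+1$ if and only if around every point $x_o\in M$ there is an admissible tuple $(s,\omega^0,\dots,\omega^{p-1})$ on some open $\mathcal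 U\ni x_o$ with $[\Omega^{p-1}|_x]=0$ in $H^{p,2}(\tilde{\mathfrak h},W)$ for all $x\in\mathcal U$. -/

import Mathlib

open scoped Manifold ContDiff Matrix

noncomputable section

/-! ### Graded Lie algebras of depth one and their generalized Spencer cohomology -/

/-- A real Lie algebra structure on the vector space `𝔥` (a bilinear, alternating bracket that
satisfies the Jacobi identity) with a grading `𝔥 = 𝔥⁻¹ ⊕ 𝔥⁰ ⊕ ⋯ ⊕ 𝔥ᵏ⁻¹`,
`[𝔥ʳ, 𝔥ˢ] ⊆ 𝔥ʳ⁺ˢ`, where `𝔥ᵖ = 0` for `p ∉ {-1, …, k-1}`. The bracket is a field, not a `LieRing`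
instance, so that `𝔥` can carry a norm as well. -/
structure GradedLie (𝔥 : Type*) [AddCommGroup 𝔥] [Module ℝ 𝔥] (k : ℕ) where
  bracket : 𝔥 →ₗ[ℝ] 𝔥 →ₗ[ℝ] 𝔥
  bracket_self : ∀ X, bracket X X = 0
  jacobi : ∀ X Y Z,
    bracket X (bracket Y Z) = bracket (bracket X Y) Z + bracket Y (bracket X Z)
  piece : ℤ → Submodule ℝ 𝔥
  isInternal : DirectSum.IsInternal piece
  bracket_mem : ∀ r s X Y, X ∈ piece r → Y ∈ piece s → bracket X Y ∈ piece (r + s)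
  piece_eq_bot : ∀ p : ℤ, p < -1 ∨ (k : ℤ) ≤ p → piece p = ⊥

/-- The alternation `(v₀, …, v_q) ↦ ∑ᵢ (-1)ⁱ A(vᵢ)(c(v₀, …, v̂ᵢ, …, v_q))`. -/
def alternate {V F F' : Type*} [AddCommGroup V] [Module ℝ V] [AddCommGroup F] [Module ℝ F]
    [AddCommGroup F'] [Module ℝ F'] {q : ℕ} (A : V →ₗ[ℝ] F →ₗ[ℝ] F') (c : V [⋀^Fin q]→ₗ[ℝ] F) :
    V [⋀^Fin (q + 1)]→ₗ[ℝ] F' :=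
  AlternatingMap.alternatizeUncurryFin
    { toFun := fun v => (A v).compAlternatingMap c
      map_add' := fun v w => by ext; simp
      map_smul' := fun a v => by ext; simp }

theorem alternate_apply {V F F' : Type*} [AddCommGroup V] [Module ℝ V] [AddCommGroup F]
    [Module ℝ F] [AddCommGroup F'] [Module ℝ F'] {q : ℕ} (A : V →ₗ[ℝ] F →ₗ[ℝ] F')
    (c : V [⋀^Fin q]→ₗ[ℝ] F) (v : Fin (q + 1) → V) :
    alternate A c v = ∑ i : Fin (q + 1), (-1) ^ (i : ℕ) • A (v i) (c (i.removeNth v)) := by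
  simp [alternate, AlternatingMap.alternatizeUncurryFin_apply]

theorem alternate_add {V F F' : Type*} [AddCommGroup V] [Module ℝ V] [AddCommGroup F]
    [Module ℝ F] [AddCommGroup F'] [Module ℝ F'] {q : ℕ} (A : V →ₗ[ℝ] F →ₗ[ℝ] F')
    (c c' : V [⋀^Fin q]→ₗ[ℝ] F) : alternate A (c + c') = alternate A c + alternate A c' := by
  ext v
  simp [alternate_apply, Finset.sum_add_distrib]

theorem alternate_smul {V F F' : Type*} [AddCommGroup V] [Module ℝ V] [AddCommGroup F]
    [Module ℝ F] [AddCommGroup F'] [Module ℝ F'] {q : ℕ} (A : V →ₗ[ℝ] F →ₗ[ℝ] F')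
    (a : ℝ) (c : V [⋀^Fin q]→ₗ[ℝ] F) : alternate A (a • c) = a • alternate A c := by
  ext v
  simp only [alternate_apply, AlternatingMap.smul_apply, map_smul, Finset.smul_sum]
  exact Finset.sum_congr rfl fun i _ => smul_comm _ _ _

namespace GradedLie

section Algebra

variable {𝔥 : Type*} [AddCommGroup 𝔥] [Module ℝ 𝔥] {k : ℕ} (L : GradedLie 𝔥 k)

/-- The decomposition of `𝔥` into its graded pieces. -/
@[reducible] def decomposition : DirectSum.Decomposition L.piece :=
  L.isInternal.chooseDecomposition

/-- The projection `X ↦ X^{𝔥ˡ}` of `𝔥` onto the graded piece `𝔥ˡ`. -/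
def proj (l : ℤ) : 𝔥 →ₗ[ℝ] L.piece l :=
  letI := L.decomposition
  DirectSum.component ℝ ℤ (fun i => L.piece i) l ∘ₗ
    (DirectSum.decomposeLinearEquiv L.piece).toLinearMap

/-- The component in `𝔥ˡ` of the bracket of an element of `𝔥ⁱ` and an element of `𝔥ʲ`;
it is the bracket itself when `i + j = l`, see `coe_bracketProj`. -/
def bracketProj (i j l : ℤ) : L.piece i →ₗ[ℝ] L.piece j →ₗ[ℝ] L.piece l :=
  (L.bracket.domRestrict₁₂ (L.piece i) (L.piece j)).compr₂ (L.proj l)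

theorem coe_proj_of_mem {l : ℤ} {X : 𝔥} (hX : X ∈ L.piece l) : (L.proj l X : 𝔥) = X := by
  let := L.decomposition
  exact DirectSum.decompose_of_mem_same L.piece hX

theorem coe_bracketProj {i j l : ℤ} (h : i + j = l) (X : L.piece i) (Y : L.piece j) :
    (L.bracketProj i j l X Y : 𝔥) = L.bracket X Y := by
  subst h
  exact L.coe_proj_of_mem (L.bracket_mem i j X Y X.2 Y.2)

variable (W : Submodule ℝ (L.piece (-1)))

/-- The iterated bracket `X ↦ [… [[X, w₁], w₂] …, w_r]` with `w₁, …, w_r` in `W ⊆ 𝔥⁻¹`. -/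
def iterBracket : List W → 𝔥 →ₗ[ℝ] 𝔥
  | [] => LinearMap.id
  | w :: l => iterBracket l ∘ₗ L.bracket.flip ((w : L.piece (-1)) : 𝔥)

theorem iterBracket_append (l₁ l₂ : List W) (X : 𝔥) :
    L.iterBracket W (l₁ ++ l₂) X = L.iterBracket W l₂ (L.iterBracket W l₁ X) := by
  induction l₁ generalizing X with
  | nil => rfl
  | cons w l ih => exact ih _

/-- The annihilator of level `r` in `𝔥ʲ`:
all `X ∈ 𝔥ʲ` with `[… [[X, w₁], w₂] …, w_r] = 0` for all `w₁, …, w_r ∈ W`. -/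
def annihilator (r : ℕ) (j : ℤ) : Submodule ℝ (L.piece j) where
  carrier := {X | ∀ l : List W, l.length = r → L.iterBracket W l X = 0}
  add_mem' hX hY l hl := by simp [hX l hl, hY l hl]
  zero_mem' l _ := by simp
  smul_mem' c X hX l hl := by simp [hX l hl]

/-- The subspace divided out in the cochains of level `r`: nothing in degree `𝔥⁻¹`, and the
annihilator of level `r` in `𝔥ᵖ⁻¹` for `p ≥ 1`. -/
def levelSub (r : ℕ) : (p : ℕ) → Submodule ℝ (L.piece ((p : ℤ) - 1))
  | 0 => ⊥
  | p + 1 => L.annihilator W r (((p + 1 : ℕ) : ℤ) - 1)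

/-- At level `0` nothing is divided out. -/
theorem levelSub_zero (p : ℕ) : L.levelSub W 0 p = ⊥ := by
  cases p with
  | zero => rfl
  | succ p =>
    rw [eq_bot_iff]
    intro X hX
    have h := hX [] rfl
    simpa [iterBracket] using h

/-- The coefficients of the cochains of level `r`: `𝔥⁻¹` for `p = 0`, and the quotient of `𝔥ᵖ⁻¹`
by its annihilator of level `r` for `p ≥ 1`. -/
def Coeff (r p : ℕ) : Type _ := L.piece ((p : ℤ) - 1) ⧸ L.levelSub W r p

instance (r p : ℕ) : AddCommGroup (L.Coeff W r p) :=
  inferInstanceAs (AddCommGroup (L.piece ((p : ℤ) - 1) ⧸ L.levelSub W r p))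

instance (r p : ℕ) : Module ℝ (L.Coeff W r p) :=
  inferInstanceAs (Module ℝ (L.piece ((p : ℤ) - 1) ⧸ L.levelSub W r p))

/-- The projection `p'_r` of `𝔥ᵖ⁻¹` onto the coefficients of level `r`. -/
def toCoeff (r p : ℕ) : L.piece ((p : ℤ) - 1) →ₗ[ℝ] L.Coeff W r p :=
  (L.levelSub W r p).mkQ

/-- The cochains `C_r^{p,q}(𝔥, W) = (𝔥ᵖ⁻¹ / 𝔠_r^{p-1}) ⊗ Λ^q W*`, as alternating maps.
For `r = 0` this is `C^{p,q}(𝔥, W) = 𝔥ᵖ⁻¹ ⊗ Λ^q W*`. -/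
abbrev Cochain (r p q : ℕ) : Type _ := W [⋀^Fin q]→ₗ[ℝ] L.Coeff W r p

/-- For `w ∈ W` the map `X ↦ [X, w]` from `𝔥ᵖ` to `𝔥ᵖ⁻¹`. -/
def bracketRight (p : ℕ) (w : W) :
    L.piece (((p + 1 : ℕ) : ℤ) - 1) →ₗ[ℝ] L.piece ((p : ℤ) - 1) :=
  (L.bracketProj _ _ _).flip (w : L.piece (-1))

theorem coe_bracketRight (p : ℕ) (w : W) (X : L.piece (((p + 1 : ℕ) : ℤ) - 1)) :
    (L.bracketRight W p w X : 𝔥) = L.bracket X ((w : L.piece (-1)) : 𝔥) :=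
  L.coe_bracketProj (show (((p + 1 : ℕ) : ℤ) - 1) + (-1) = (p : ℤ) - 1 by push_cast; ring) X w

/-- Bracketing with `W` descends to the coefficients of level `r`, as long as `r ≤ p + 1`. -/
theorem levelSub_le_comap (r p : ℕ) (h : r ≤ p + 1) (w : W) :
    L.levelSub W r (p + 1) ≤ (L.levelSub W r p).comap (L.bracketRight W p w) := by
  intro X hX
  have hX' : ∀ l : List W, l.length = r → L.iterBracket W l X = 0 := hX
  rw [Submodule.mem_comap]
  have key : ∀ l : List W, r ≤ l.length → L.iterBracket W l X = 0 := by
    intro l hl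
    rw [← List.take_append_drop r l, iterBracket_append,
      hX' _ (by rw [List.length_take]; omega), map_zero]
  cases p with
  | zero =>
    have h0 : (L.bracketRight W 0 w X : 𝔥) = 0 := by
      rw [coe_bracketRight]
      exact key [w] (by simpa using h)
    have h1 : L.bracketRight W 0 w X = 0 := Subtype.ext h0
    rw [h1]
    exact Submodule.zero_mem _
  | succ p =>
    intro l hl
    rw [coe_bracketRight]
    exact key (w :: l) (by simp [hl])

/-- For `w ∈ W` the map `X ↦ p'_r ∘ [X, w]` on coefficients of level `r`, linear in `w`. -/
def coeffBracket (r p : ℕ) (h : r ≤ p + 1) :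
    W →ₗ[ℝ] L.Coeff W r (p + 1) →ₗ[ℝ] L.Coeff W r p where
  toFun w := Submodule.mapQ _ _ (L.bracketRight W p w) (L.levelSub_le_comap W r p h w)
  map_add' w w' := by
    refine LinearMap.ext fun X => ?_
    obtain ⟨X, rfl⟩ := (L.levelSub W r (p + 1)).mkQ_surjective X
    change L.toCoeff W r p (L.bracketRight W p (w + w') X)
      = L.toCoeff W r p (L.bracketRight W p w X) + L.toCoeff W r p (L.bracketRight W p w' X)
    simp [bracketRight]
  map_smul' c w := by
    refine LinearMap.ext fun X => ?_
    obtain ⟨X, rfl⟩ := (L.levelSub W r (p + 1)).mkQ_surjective X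
    change L.toCoeff W r p (L.bracketRight W p (c • w) X)
      = c • L.toCoeff W r p (L.bracketRight W p w X)
    simp [bracketRight]

theorem coeffBracket_toCoeff (r p : ℕ) (h : r ≤ p + 1) (w : W)
    (X : L.piece (((p + 1 : ℕ) : ℤ) - 1)) :
    L.coeffBracket W r p h w (L.toCoeff W r (p + 1) X) = L.toCoeff W r p (L.bracketRight W p w X) :=
  rfl

/-- The generalized Spencer operator `∂ : C_r^{p+1,q}(𝔥, W) → C_r^{p,q+1}(𝔥, W)`,
`∂c(w₁, …, w_{q+1}) = ∑ᵢ (-1)ⁱ p'_r ∘ [c(w₁, …, ŵᵢ, …, w_{q+1}), wᵢ]` (`1 ≤ i ≤ q + 1`). -/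
def spencer (r p q : ℕ) (h : r ≤ p + 1) :
    L.Cochain W r (p + 1) q →ₗ[ℝ] L.Cochain W r p (q + 1) where
  toFun c := -alternate (L.coeffBracket W r p h) c
  map_add' c c' := by rw [alternate_add, neg_add]
  map_smul' a c := by rw [alternate_smul, RingHom.id_apply, smul_neg]

/-- The cocycles `Z_r^{p,q}(𝔥, W)`: the kernel of `∂ : C_r^{p,q} → C_r^{p-1,q+1}`, where
`C_r^{-1,q+1} = 0`. -/
def cocycles (r : ℕ) : (p : ℕ) → r ≤ p → (q : ℕ) → Submodule ℝ (L.Cochain W r p q)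
  | 0, _, _ => ⊤
  | p + 1, h, q => LinearMap.ker (L.spencer W r p q h)

/-- The coboundaries `B_r^{p,q}(𝔥, W)`: the image of `∂ : C_r^{p+1,q-1} → C_r^{p,q}`. -/
def coboundaries (r p : ℕ) (h : r ≤ p) : (q : ℕ) → Submodule ℝ (L.Cochain W r p q)
  | 0 => ⊥
  | q + 1 => LinearMap.range (L.spencer W r p q (h.trans p.le_succ))

/-- The generalized Spencer cohomology group `H_r^{p,q}(𝔥, W) = Z_r^{p,q} / B_r^{p,q}` of level
`r ≤ p`. For `r = 0` this is `H^{p,q}(𝔥, W)`. -/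
abbrev Cohomology (r p : ℕ) (h : r ≤ p) (q : ℕ) : Type _ :=
  L.cocycles W r p h q ⧸ (L.coboundaries W r p h q).submoduleOf (L.cocycles W r p h q)

end Algebra

end GradedLie

/-! ### Vector-valued differential forms on a manifold -/

section Forms

/-- Differential `q`-forms on the `n`-dimensional manifold `M` with values in `F` (no regularity
imposed). A form defined on an open subset is extended by arbitrary values. -/
abbrev DiffForm (n : ℕ) (M : Type*) [TopologicalSpace M]
    [ChartedSpace (EuclideanSpace ℝ (Fin n)) M] (q : ℕ) (F : Type*) [NormedAddCommGroup F]
    [NormedSpace ℝ F] : Type _ :=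
  (x : M) → TangentSpace (𝓡 n) x [⋀^Fin q]→L[ℝ] F

namespace DiffForm

variable {n : ℕ} {M : Type*} [TopologicalSpace M] [ChartedSpace (EuclideanSpace ℝ (Fin n)) M]
  {q : ℕ} {F : Type*} [NormedAddCommGroup F] [NormedSpace ℝ F]

/-- The expression of a form in the chart around `x₀`: its pull-back under the inverse chart. -/
def inChart (η : DiffForm n M q F) (x₀ : M) :
    EuclideanSpace ℝ (Fin n) → EuclideanSpace ℝ (Fin n) [⋀^Fin q]→L[ℝ] F :=
  fun y => (η ((extChartAt (𝓡 n) x₀).symm y)).compContinuousLinearMap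
    (mfderiv 𝓘(ℝ, EuclideanSpace ℝ (Fin n)) (𝓡 n) (extChartAt (𝓡 n) x₀).symm y)

/-- A form is smooth on `U` if its expression in each chart is. -/
def SmoothOn (η : DiffForm n M q F) (U : Set M) : Prop :=
  ∀ x₀ : M, ContDiffOn ℝ ∞ (η.inChart x₀)
    ((extChartAt (𝓡 n) x₀).target ∩ (extChartAt (𝓡 n) x₀).symm ⁻¹' U)

/-- The exterior derivative, computed at `x` in the chart around `x`:
`dη(v₀, …, v_q) = ∑ᵢ (-1)ⁱ vᵢ(η(v₀, …, v̂ᵢ, …, v_q))` for coordinate vector fields. -/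
def extDer (η : DiffForm n M q F) : DiffForm n M (q + 1) F :=
  fun x => (extDeriv (η.inChart x) (extChartAt (𝓡 n) x x)).compContinuousLinearMap
    (mfderiv (𝓡 n) 𝓘(ℝ, EuclideanSpace ℝ (Fin n)) (extChartAt (𝓡 n) x) x)

end DiffForm

/-- For 1-forms `α`, `β` at a point and a bilinear map `B` the 2-form
`(v₀, v₁) ↦ B(α(v₀), β(v₁)) - B(α(v₁), β(v₀))`. -/
def wedgeBilin {T F₁ F₂ F₃ : Type*} [AddCommGroup T] [Module ℝ T] [AddCommGroup F₁] [Module ℝ F₁]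
    [AddCommGroup F₂] [Module ℝ F₂] [AddCommGroup F₃] [Module ℝ F₃]
    (B : F₁ →ₗ[ℝ] F₂ →ₗ[ℝ] F₃) (α : T [⋀^Fin 1]→ₗ[ℝ] F₁) (β : T [⋀^Fin 1]→ₗ[ℝ] F₂) :
    T [⋀^Fin 2]→ₗ[ℝ] F₃ :=
  alternate (((LinearMap.llcomp ℝ T F₁ _).flip
    ((AlternatingMap.ofSubsingleton ℝ T F₁ (0 : Fin 1)).symm α)) B) β

theorem wedgeBilin_apply {T F₁ F₂ F₃ : Type*} [AddCommGroup T] [Module ℝ T] [AddCommGroup F₁]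
    [Module ℝ F₁] [AddCommGroup F₂] [Module ℝ F₂] [AddCommGroup F₃] [Module ℝ F₃]
    (B : F₁ →ₗ[ℝ] F₂ →ₗ[ℝ] F₃) (α : T [⋀^Fin 1]→ₗ[ℝ] F₁) (β : T [⋀^Fin 1]→ₗ[ℝ] F₂) (v w : T) :
    wedgeBilin B α β ![v, w] = B (α ![v]) (β ![w]) - B (α ![w]) (β ![v]) := by
  have h : ∀ x y : T, Fin.removeNth (α := fun _ => T) 1 ![x, y] = ![x] := fun x y => by
    ext i
    fin_cases i
    rfl
  have h' : ∀ x y : T, Fin.removeNth (α := fun _ => T) 0 ![x, y] = ![y] := fun x y => by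
    ext i
    fin_cases i
    rfl
  have h2 : ∀ x : T, (fun _ : Fin 1 => x) = ![x] := fun x => by
    ext i
    fin_cases i
    rfl
  simp [wedgeBilin, alternate_apply, Fin.sum_univ_two, h, h', h2, sub_eq_add_neg]

end Forms

/-! ### G-structures -/

section GStructures

variable {n : ℕ}

/-- A `G`-structure on an `n`-dimensional manifold `M`, for a closed subgroup `G` of `GL_n(ℝ)`:
a reduction of the bundle of linear frames to `G`. It is given by its set of frames at each point,
on which `G` acts simply transitively by `e'_j = ∑ᵢ A i j • e_i`, and which admits smooth local
sections around each point. -/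
structure GStructure (G : Subgroup (Matrix.GeneralLinearGroup (Fin n) ℝ)) (M : Type*)
    [TopologicalSpace M] [ChartedSpace (EuclideanSpace ℝ (Fin n)) M] [IsManifold (𝓡 n) ∞ M] where
  isClosed : IsClosed (G : Set (Matrix.GeneralLinearGroup (Fin n) ℝ))
  frames : (x : M) → Set (Module.Basis (Fin n) ℝ (TangentSpace (𝓡 n) x))
  act_mem : ∀ (x : M) (u u' : Module.Basis (Fin n) ℝ (TangentSpace (𝓡 n) x)), ∀ A ∈ G,
    u ∈ frames x → (∀ j, u' j = ∑ i, A i j • u i) → u' ∈ frames x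
  exists_act : ∀ (x : M), ∀ u ∈ frames x, ∀ u' ∈ frames x, ∃ A ∈ G, ∀ j, u' j = ∑ i, A i j • u i
  exists_section : ∀ x₀ : M, ∃ (U : Set M)
    (s : (x : M) → Module.Basis (Fin n) ℝ (TangentSpace (𝓡 n) x)), IsOpen U ∧ x₀ ∈ U ∧
      (∀ x ∈ U, s x ∈ frames x) ∧
      ∀ i, ContMDiffOn (𝓡 n) (𝓡 n).tangent ∞
        (fun x => (⟨x, s x i⟩ : TangentBundle (𝓡 n) M)) U

/-- `s` is a smooth section over `U` of the `G`-structure `P`; its values outside `U` are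
arbitrary. The pull-backs `s^*ϑ¹, …, s^*ϑⁿ` of the components of the soldering form are then
`v ↦ (s x).repr v i`, the components of `v ∈ T_x M` with respect to the frame `s x`. -/
def GStructure.IsSection {G : Subgroup (Matrix.GeneralLinearGroup (Fin n) ℝ)} {M : Type*}
    [TopologicalSpace M] [ChartedSpace (EuclideanSpace ℝ (Fin n)) M] [IsManifold (𝓡 n) ∞ M]
    (P : GStructure G M)
    (U : Set M) (s : (x : M) → Module.Basis (Fin n) ℝ (TangentSpace (𝓡 n) x)) : Prop :=
  (∀ x ∈ U, s x ∈ P.frames x) ∧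
    ∀ i, ContMDiffOn (𝓡 n) (𝓡 n).tangent ∞ (fun x => (⟨x, s x i⟩ : TangentBundle (𝓡 n) M)) U

end GStructures

/-! ### Flat k-reductive homogeneous structures -/

section Isotropy

variable (d : ℕ) {H : Type*} [Group H] {N : Type*} [TopologicalSpace N]
  [ChartedSpace (EuclideanSpace ℝ (Fin d)) N] [MulAction H N]

/-- The isotropy representation: the differential at `o` of the action of an element of the
stabilizer of `o`. -/
def isotropyDeriv (o : N) (h : MulAction.stabilizer H o) :
    TangentSpace (𝓡 d) o →L[ℝ] TangentSpace (𝓡 d) o :=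
  mfderiv (𝓡 d) (𝓡 d) (fun z : N => (h : H) • z) o

theorem isotropyDeriv_one (o : N) :
    isotropyDeriv d o (1 : MulAction.stabilizer H o) = ContinuousLinearMap.id ℝ _ := by
  have : (fun z : N => ((1 : MulAction.stabilizer H o) : H) • z) = id := by
    ext z
    simp
  unfold isotropyDeriv
  rw [this]
  exact mfderiv_id

variable {E : Type*} [NormedAddCommGroup E] [NormedSpace ℝ E]
  [TopologicalSpace H] [ChartedSpace E H]

variable (H) in
/-- The differential at the identity of the orbit map `h ↦ h • o`, from the Lie algebra of `H` to
`T_o N`; its kernel is the Lie algebra of the stabilizer of `o`. -/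
def orbitDeriv (o : N) : GroupLieAlgebra 𝓘(ℝ, E) H →L[ℝ] TangentSpace (𝓡 d) o :=
  mfderiv 𝓘(ℝ, E) (𝓡 d) (fun h : H => h • o) 1

theorem isotropyDeriv_mul [ContMDiffSMul 𝓘(ℝ, E) (𝓡 d) ∞ H N] (o : N)
    (h h' : MulAction.stabilizer H o) :
    isotropyDeriv d o (h * h') = (isotropyDeriv d o h).comp (isotropyDeriv d o h') := by
  have hd : ∀ (g : H) (z : N),
      MDifferentiableAt (𝓡 d) (𝓡 d) (fun z : N => g • z) z := by
    intro g z
    have h1 : ContMDiff (𝓡 d) (𝓡 d) ∞ (fun z : N => g • z) :=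
      (contMDiff_smul (I := 𝓘(ℝ, E)) (I' := 𝓡 d) (n := ∞) (G := H) (M := N)).comp
        (contMDiff_const.prodMk contMDiff_id)
    exact (h1 z).mdifferentiableAt (by simp)
  have h1 : (fun z : N => ((h * h' : MulAction.stabilizer H o) : H) • z)
      = (fun z : N => (h : H) • z) ∘ (fun z : N => (h' : H) • z) := by
    ext z
    simp [mul_smul]
  have h2 : (h' : H) • o = o := h'.2
  have h3 := (hd h o).hasMFDerivAt
  have h4 := (hd h' o).hasMFDerivAt
  have h5 : HasMFDerivAt (𝓡 d) (𝓡 d) (fun z : N => (h : H) • z) ((h' : H) • o)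
      (mfderiv (𝓡 d) (𝓡 d) (fun z : N => (h : H) • z) o) := by
    rw [h2]
    exact h3
  unfold isotropyDeriv
  rw [h1]
  exact (HasMFDerivAt.comp o h5 h4).mfderiv

end Isotropy

section Homogeneous

variable {n m k : ℕ} {𝔥 : Type*} [NormedAddCommGroup 𝔥] [NormedSpace ℝ 𝔥]
  {E : Type*} [NormedAddCommGroup E] [NormedSpace ℝ E] [FiniteDimensional ℝ E]
  {H : Type*} [TopologicalSpace H] [ChartedSpace E H] [Group H] [LieGroup 𝓘(ℝ, E) ∞ H]
  {N : Type*} [TopologicalSpace N] [ChartedSpace (EuclideanSpace ℝ (Fin (n + m))) N]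
  [IsManifold (𝓡 (n + m)) ∞ N] [MulAction H N] [ContMDiffSMul 𝓘(ℝ, E) (𝓡 (n + m)) ∞ H N]

/-- A flat `k`-reductive homogeneous structure on the homogeneous manifold `N = H/K` of dimension
`n + m`: a connected Lie group `H` that acts smoothly, transitively and effectively on `N`, a base
point `o` with stabilizer `K`, a linear frame `e` at `o`, indexed so that its first `n` and its last
`m` vectors are distinguished, and a grading of height `k` of `Lie(H)`, written as a normed space
`𝔥` with an isomorphism to `Lie(H)`, such that `Lie(K) = 𝔥⁰ + ⋯ + 𝔥ᵏ⁻¹`. -/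
structure FlatReductive (n m k : ℕ) (𝔥 : Type*) [NormedAddCommGroup 𝔥] [NormedSpace ℝ 𝔥]
    (E : Type*) [NormedAddCommGroup E] [NormedSpace ℝ E] [FiniteDimensional ℝ E]
    (H : Type*) [TopologicalSpace H] [ChartedSpace E H] [Group H] [LieGroup 𝓘(ℝ, E) ∞ H]
    (N : Type*) [TopologicalSpace N] [ChartedSpace (EuclideanSpace ℝ (Fin (n + m))) N]
    [IsManifold (𝓡 (n + m)) ∞ N] [MulAction H N]
    [ContMDiffSMul 𝓘(ℝ, E) (𝓡 (n + m)) ∞ H N] where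
  connected : ConnectedSpace H
  transitive : MulAction.IsPretransitive H N
  effective : FaithfulSMul H N
  base : N
  frame : Module.Basis (Fin n ⊕ Fin m) ℝ (TangentSpace (𝓡 (n + m)) base)
  lie : GradedLie 𝔥 k
  lieEquiv : 𝔥 ≃ₗ[ℝ] GroupLieAlgebra 𝓘(ℝ, E) H
  lieEquiv_bracket : ∀ X Y, lieEquiv (lie.bracket X Y) = ⁅lieEquiv X, lieEquiv Y⁆
  isotropy : ∀ X : 𝔥,
    orbitDeriv (n + m) H base (lieEquiv X) = 0 ↔ X ∈ ⨆ p : ℕ, lie.piece (p : ℤ)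

namespace FlatReductive

variable (S : FlatReductive n m k 𝔥 E H N)

/-- The homogeneous structure `P̃` itself: the orbit `H · e` of the frame `e` in the bundle of
linear frames of `N`. These are its frames at `y`. -/
def homFrames (y : N) : Set (Module.Basis (Fin n ⊕ Fin m) ℝ (TangentSpace (𝓡 (n + m)) y)) :=
  {u | ∃ h : H, h • S.base = y ∧ ∀ j,
    tangentMap (𝓡 (n + m)) (𝓡 (n + m)) (fun z : N => h • z) ⟨S.base, S.frame j⟩ = ⟨y, u j⟩}

/-- The isotropy representation of the stabilizer `K` of the base point, in the frame `e`. -/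
def isotropyRep :
    MulAction.stabilizer H S.base →* Matrix (Fin n ⊕ Fin m) (Fin n ⊕ Fin m) ℝ where
  toFun h := LinearMap.toMatrix S.frame S.frame
    (isotropyDeriv (n + m) S.base h : _ →ₗ[ℝ] TangentSpace (𝓡 (n + m)) S.base)
  map_one' := by
    rw [isotropyDeriv_one]
    exact LinearMap.toMatrix_id _
  map_mul' h h' := by
    rw [isotropyDeriv_mul (n + m) (E := E) S.base h h']
    exact LinearMap.toMatrix_comp S.frame S.frame S.frame _ _

/-- The structure group `G̃ ⊆ GL_{n+m}(ℝ)` of the homogeneous structure, the image of the isotropy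
representation. It consists of the `A` for which the frame `e · A` belongs to `P̃`, see
`mem_structureGroup_iff`. -/
def structureGroup : Subgroup (Matrix.GeneralLinearGroup (Fin n ⊕ Fin m) ℝ) :=
  S.isotropyRep.toHomUnits.range

theorem mem_structureGroup_iff (A : Matrix.GeneralLinearGroup (Fin n ⊕ Fin m) ℝ) :
    A ∈ S.structureGroup ↔ ∃ u ∈ S.homFrames S.base, ∀ j, u j = ∑ i, A i j • S.frame i := by
  have hmat : ∀ h : MulAction.stabilizer H S.base, S.isotropyRep h = A.1 ↔
      ∀ j, isotropyDeriv (n + m) S.base h (S.frame j) = ∑ i, A i j • S.frame i := by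
    intro h
    have h1 : S.isotropyRep h = A.1 ↔
        (isotropyDeriv (n + m) S.base h : _ →ₗ[ℝ] TangentSpace (𝓡 (n + m)) S.base)
          = Matrix.toLin S.frame S.frame A.1 := by
      rw [← (LinearMap.toMatrix S.frame S.frame).injective.eq_iff,
        LinearMap.toMatrix_toLin S.frame S.frame]
      rfl
    rw [h1]
    constructor
    · intro h2 j
      rw [← Matrix.toLin_self S.frame S.frame, ← h2]
      rfl
    · intro h2
      refine S.frame.ext fun j => ?_
      rw [Matrix.toLin_self]
      exact h2 j
  have htan : ∀ (h : H) (hh : h ∈ MulAction.stabilizer H S.base)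
      (v w : TangentSpace (𝓡 (n + m)) S.base),
      tangentMap (𝓡 (n + m)) (𝓡 (n + m)) (fun z : N => h • z) ⟨S.base, v⟩ = ⟨S.base, w⟩ ↔
        isotropyDeriv (n + m) S.base ⟨h, hh⟩ v = w := by
    intro h hh v w
    constructor
    · intro h1
      exact eq_of_heq ((Bundle.TotalSpace.mk.inj h1).2)
    · intro h1
      subst h1
      have key : ∀ (y : N), y = S.base → ∀ a : EuclideanSpace ℝ (Fin (n + m)),
          (⟨y, a⟩ : TangentBundle (𝓡 (n + m)) N) = ⟨S.base, a⟩ := by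
        rintro y rfl a
        rfl
      exact key _ hh _
  constructor
  · rintro ⟨h, hA⟩
    have hA' : S.isotropyRep h = A.1 := congrArg Units.val hA
    have hdet : IsUnit A.1.det := (Matrix.isUnit_iff_isUnit_det _).1 A.isUnit
    have hu : ∀ j, S.frame.map (Matrix.toLinearEquiv S.frame A.1 hdet) j
        = ∑ i, A i j • S.frame i := fun j => by
      rw [Module.Basis.map_apply]
      exact Matrix.toLin_self S.frame S.frame A.1 j
    refine ⟨_, ⟨h, h.2, fun j => ?_⟩, hu⟩
    rw [htan h.1 h.2, hu]
    exact (hmat h).1 hA' j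
  · rintro ⟨u, ⟨h, hh, hu⟩, huA⟩
    refine ⟨⟨h, hh⟩, Units.ext ?_⟩
    refine (hmat ⟨h, hh⟩).2 fun j => ?_
    rw [← huA]
    exact (htan h hh _ _).1 (hu j)

/-- The subgroup `G_♯ = {(A, B; 0, D) ∈ G̃}`. -/
def gSharp : Subgroup (Matrix.GeneralLinearGroup (Fin n ⊕ Fin m) ℝ) where
  carrier := {A | A ∈ S.structureGroup ∧ A.1.toBlocks₂₁ = 0}
  one_mem' := ⟨one_mem _, by ext i j; simp [Matrix.toBlocks₂₁]⟩
  mul_mem' := by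
    rintro A B ⟨hA, hA'⟩ ⟨hB, hB'⟩
    refine ⟨mul_mem hA hB, ?_⟩
    rw [Units.val_mul, ← Matrix.fromBlocks_toBlocks A.1, ← Matrix.fromBlocks_toBlocks B.1, hA', hB',
      Matrix.fromBlocks_multiply]
    simp
  inv_mem' := by
    rintro A ⟨hA, hA'⟩
    refine ⟨inv_mem hA, ?_⟩
    have h1 : (A⁻¹).1 * A.1 = 1 := A.inv_mul
    have h2 : IsUnit A.1.det := (Matrix.isUnit_iff_isUnit_det _).1 A.isUnit
    rw [← Matrix.fromBlocks_toBlocks A.1, hA', Matrix.det_fromBlocks_zero₂₁] at h2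
    have h3 : IsUnit A.1.toBlocks₁₁.det := isUnit_of_mul_isUnit_left h2
    have h4 : (A⁻¹).1.toBlocks₂₁ * A.1.toBlocks₁₁ = 0 := by
      rw [← Matrix.fromBlocks_toBlocks A.1, ← Matrix.fromBlocks_toBlocks (A⁻¹).1, hA',
        Matrix.fromBlocks_multiply, ← Matrix.fromBlocks_one, Matrix.fromBlocks_inj] at h1
      simpa using h1.2.2.1
    have h5 := congrArg (· * (A.1.toBlocks₁₁)⁻¹) h4
    simpa [Matrix.mul_assoc, Matrix.mul_nonsing_inv _ h3] using h5

/-- The homomorphism `(A, B; 0, D) ↦ A` on `G_♯`. -/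
def upperLeft : S.gSharp →* Matrix (Fin n) (Fin n) ℝ where
  toFun A := A.1.1.toBlocks₁₁
  map_one' := by ext i j; simp [Matrix.toBlocks₁₁, Matrix.one_apply]
  map_mul' A B := by
    have h := B.2.2
    change (A.1.1 * B.1.1).toBlocks₁₁ = _
    conv_lhs => rw [← Matrix.fromBlocks_toBlocks A.1.1, ← Matrix.fromBlocks_toBlocks B.1.1, h,
      Matrix.fromBlocks_multiply]
    simp

/-- The normal subgroup `N_♯ = {(I, B; 0, D) ∈ G̃}` of `G_♯`. -/
def nSharp : Subgroup S.gSharp := S.upperLeft.ker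

instance : S.nSharp.Normal := inferInstanceAs S.upperLeft.ker.Normal

/-- The identification of `𝔥⁻¹` with `V = ℝⁿ⁺ᵐ`, through `𝔥⁻¹ ≃ 𝔥/Lie(K) ≃ T_o N` and the frame
`e`. -/
def coord : S.lie.piece (-1) →ₗ[ℝ] (Fin n ⊕ Fin m → ℝ) :=
  S.frame.equivFun.toLinearMap ∘ₗ (orbitDeriv (n + m) H S.base).toLinearMap ∘ₗ
    S.lieEquiv.toLinearMap ∘ₗ (S.lie.piece (-1)).subtype

/-- The subspace `W` of `V ≃ 𝔥⁻¹` where the last `m` coordinates vanish. -/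
def W : Submodule ℝ (S.lie.piece (-1)) where
  carrier := {X | ∀ j : Fin m, S.coord X (Sum.inr j) = 0}
  add_mem' hX hY j := by simp [hX j, hY j]
  zero_mem' j := by simp
  smul_mem' c X hX j := by simp [hX j]

section Immersion

variable {M : Type*} [TopologicalSpace M] [ChartedSpace (EuclideanSpace ℝ (Fin n)) M]

/-- The identification of `W ≃ ℝⁿ` with the tangent space `T_x M` by a frame `u` at `x`. -/
def frameMap {x : M} (u : Module.Basis (Fin n) ℝ (TangentSpace (𝓡 n) x)) :
    S.W →ₗ[ℝ] TangentSpace (𝓡 n) x :=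
  u.equivFun.symm.toLinearMap ∘ₗ LinearMap.funLeft ℝ ℝ Sum.inl ∘ₗ S.coord ∘ₗ S.W.subtype

/-- Families of 1-forms `ωʳ` on `M` with values in `𝔥ʳ`. -/
abbrev FormFamily (M : Type*) [TopologicalSpace M]
    [ChartedSpace (EuclideanSpace ℝ (Fin n)) M] : Type _ :=
  (r : ℤ) → DiffForm n M 1 (S.lie.piece r)

variable {S} in
/-- The 2-form `[ωⁱ, ωʲ]^{𝔥ˡ}` at `x`. -/
def FormFamily.bracket (η : S.FormFamily M) (i j l : ℤ) (x : M) :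
    TangentSpace (𝓡 n) x [⋀^Fin 2]→ₗ[ℝ] S.lie.piece l :=
  wedgeBilin (S.lie.bracketProj i j l) (η i x).toAlternatingMap (η j x).toAlternatingMap

variable {S} in
/-- The total curvature of order `p + 1`, at `x`:
`Ω^{p-1} = dω^{p-1} + ½ ∑_{r=0}^{p-1} [ωʳ, ω^{p-1-r}] + ½ [ω⁻¹, ω⁻¹]^{𝔥ᵖ⁻¹}`. -/
def FormFamily.curvature (η : S.FormFamily M) (p : ℕ) (x : M) :
    TangentSpace (𝓡 n) x [⋀^Fin 2]→ₗ[ℝ] S.lie.piece ((p : ℤ) - 1) :=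
  ((η ((p : ℤ) - 1)).extDer x).toAlternatingMap
    + (1 / 2 : ℝ) • ∑ r ∈ Finset.range p, η.bracket (r : ℤ) ((p : ℤ) - 1 - r) ((p : ℤ) - 1) x
    + (1 / 2 : ℝ) • η.bracket (-1) (-1) ((p : ℤ) - 1) x

variable {S} in
/-- The curvature `p'_r ∘ Ω^{p-1}` of level `r` and order `p + 1` at `x`, as an element of
`C_r^{p,2}(𝔥, W)` by means of the frame `u` at `x`. For `r = 0` it is the total curvature. -/
def FormFamily.curvatureCochain (η : S.FormFamily M) (r p : ℕ) {x : M}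
    (u : Module.Basis (Fin n) ℝ (TangentSpace (𝓡 n) x)) : S.lie.Cochain S.W r p 2 :=
  (S.lie.toCoeff S.W r p).compAlternatingMap ((η.curvature p x).compLinearMap (S.frameMap u))

variable [IsManifold (𝓡 n) ∞ M] {G : Subgroup (Matrix.GeneralLinearGroup (Fin n) ℝ)}

/-- `(s, ω⁰, …, ω^{p-1})`, with `ω⁻¹` determined by `s`, is an admissible tuple of order `p` on the
open set `U` for the `G`-structure `P`. Only the `ωʳ` with `-1 ≤ r ≤ p - 1` on `U` matter. -/
structure IsAdmissible (P : GStructure G M) (p : ℕ) (U : Set M)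
    (s : (x : M) → Module.Basis (Fin n) ℝ (TangentSpace (𝓡 n) x)) (η : S.FormFamily M) :
    Prop where
  isOpen : IsOpen U
  isSection : P.IsSection U s
  smooth : ∀ r : ℤ, -1 ≤ r → r ≤ (p : ℤ) - 1 → (η r).SmoothOn U
  /-- `ω⁻¹ = (s^*ϑ¹, …, s^*ϑⁿ, 0, …, 0)` -/
  soldering : ∀ x ∈ U, ∀ v : TangentSpace (𝓡 n) x,
    S.coord (η (-1) x ![v]) = Sum.elim (fun i => (s x).repr v i) (fun _ => 0)
  /-- `Ω^{q-1} = -[ω⁻¹, ω^q]` for `0 ≤ q ≤ p - 1` -/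
  structure_eq : ∀ q < p, ∀ x ∈ U,
    η.curvature q x = -η.bracket (-1) (q : ℤ) ((q : ℤ) - 1) x

/-- The `G`-structure `P` is locally immersible to order `p`. -/
def LocallyImmersible (P : GStructure G M) (p : ℕ) : Prop :=
  ∀ x₀ : M, ∃ (U : Set M) (s : (x : M) → Module.Basis (Fin n) ℝ (TangentSpace (𝓡 n) x))
    (η : S.FormFamily M), S.IsAdmissible P p U s η ∧ x₀ ∈ U

end Immersion

end FlatReductive

end Homogeneous

end

/-!
The argument is the Bianchi identity, read in one degree of the grading.

For an admissible tuple put `ω = ω⁻¹ + ω⁰ + ⋯ + ω^{p-1}`, an `𝔥`-valued 1-form, and let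
`Ω = dω + ½[ω, ω]` be its curvature. The structure equations say that the components of `Ω` of
degree at most `p - 2` vanish on `U`, and its component of degree `p - 1` is the total curvature
`Ω^{p-1}` (`proj_totalCurv_of_lt`, `proj_totalCurv_self`). The Bianchi identity `dΩ = [Ω, ω]`, a
consequence of `d² = 0` and the Jacobi identity (`bianchi`), therefore reduces in degree `p - 2` to
`[Ω^{p-1}, ω⁻¹] = 0` (`IsAdmissible.curvature_bianchi`). Since `ω⁻¹` is the inverse of the
identification of `W` with the tangent space, this is the cocycle condition, and it passes to the
quotients of all levels.

The tuple extends by a form `ωᵖ` exactly if `Ω^{p-1} = -[ω⁻¹, ωᵖ]`, and the right hand side is the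
coboundary of `-ωᵖ` at each point. This gives one direction. For the other, primitives at the
single points have to be chosen smoothly. In the frame `s` the Spencer operator has constant
coefficients: it is a fixed linear map between finite-dimensional spaces (`spencerMatrix`). A linear
generalized inverse of it, applied to the components of the curvature in the frame, gives a
primitive that depends smoothly on the point (`extendFamily`, `IsAdmissible.exists_succ`).

The exterior derivative is defined at each point by the chart around that point; that it can be
computed in any other chart (`DiffForm.extDer_inChart`) is what allows it to be differentiated again.
-/

noncomputable section

/-! ### Components and brackets in a graded Lie algebra -/

namespace GradedLie

section Components

variable {𝔥 : Type*} [AddCommGroup 𝔥] [Module ℝ 𝔥] {k : ℕ} (L : GradedLie 𝔥 k)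

theorem bracket_swap (X Y : 𝔥) : L.bracket X Y = -L.bracket Y X := by
  have h := L.bracket_self (X + Y)
  simp only [map_add, LinearMap.add_apply, L.bracket_self, zero_add, add_zero] at h
  exact eq_neg_of_add_eq_zero_right h

theorem jacobi_cyclic (X Y Z : 𝔥) :
    L.bracket (L.bracket X Y) Z + L.bracket (L.bracket Y Z) X
      + L.bracket (L.bracket Z X) Y = 0 := by
  rw [L.bracket_swap (L.bracket Y Z) X, L.jacobi X Y Z, L.bracket_swap Z X, map_neg,
    LinearMap.neg_apply, L.bracket_swap (L.bracket X Z) Y]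
  abel

theorem proj_of_mem_ne {i l : ℤ} (h : i ≠ l) {X : 𝔥} (hX : X ∈ L.piece i) : L.proj l X = 0 := by
  let := L.decomposition
  exact Subtype.ext (DirectSum.decompose_of_mem_ne L.piece hX h)

/-- Bracketing with an element of degree `j` shifts the components by `j`. -/
theorem proj_bracket (l j : ℤ) (X : 𝔥) {Y : 𝔥} (hY : Y ∈ L.piece j) :
    (L.proj l (L.bracket X Y) : 𝔥) = L.bracket (L.proj (l - j) X) Y := by
  let := L.decomposition
  induction X using DirectSum.Decomposition.inductionOn L.piece with
  | zero => simp
  | @homogeneous i X =>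
    have hXY := L.bracket_mem i j X Y X.2 hY
    by_cases h : i = l - j
    · subst h
      rw [sub_add_cancel] at hXY
      rw [L.coe_proj_of_mem hXY, L.coe_proj_of_mem X.2]
    · rw [L.proj_of_mem_ne h X.2, L.proj_of_mem_ne (fun h' => h (by omega)) hXY]
      simp
  | add X X' h h' => simp [h, h']

theorem bracket_eq_zero_of_mem {X Y : 𝔥} (hX : X ∈ L.piece (-1)) (hY : Y ∈ L.piece (-1)) :
    L.bracket X Y = 0 := by
  have h := L.bracket_mem _ _ X Y hX hY
  rwa [L.piece_eq_bot _ (Or.inl (by norm_num)), Submodule.mem_bot] at h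

theorem bracketProj_neg_one (l : ℤ) (X Y : L.piece (-1)) : L.bracketProj (-1) (-1) l X Y = 0 := by
  change L.proj l (L.bracket X Y) = 0
  rw [L.bracket_eq_zero_of_mem X.2 Y.2, map_zero]

end Components

section Total

variable {𝔥 : Type*} [AddCommGroup 𝔥] [Module ℝ 𝔥] {k : ℕ} (L : GradedLie 𝔥 k)

/-! The next lemmas compute the homogeneous components of `[α, β]`, where `α = ∑ αʳ` and `β = ∑ βʳ`
with `-1 ≤ r ≤ p - 1`. -/

theorem proj_sum_of_le {p q : ℕ} (h : q ≤ p) {α : ℤ → 𝔥} (hα : ∀ r, α r ∈ L.piece r) :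
    (L.proj ((q : ℤ) - 1) (∑ i ∈ Finset.range (p + 1), α ((i : ℤ) - 1)) : 𝔥)
      = α ((q : ℤ) - 1) := by
  rw [map_sum, Finset.sum_eq_single q, L.coe_proj_of_mem (hα _)]
  · intro i _ hi
    exact L.proj_of_mem_ne (fun h' => hi (by omega)) (hα _)
  · intro hq
    exact absurd (Finset.mem_range.2 (Nat.lt_succ_of_le h)) hq

theorem proj_sum_of_ne {p : ℕ} {l : ℤ} (h : l < -1 ∨ (p : ℤ) ≤ l) {α : ℤ → 𝔥}
    (hα : ∀ r, α r ∈ L.piece r) :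
    (L.proj l (∑ i ∈ Finset.range (p + 1), α ((i : ℤ) - 1)) : 𝔥) = 0 := by
  rw [map_sum, Finset.sum_eq_zero, ZeroMemClass.coe_zero]
  intro i hi
  rw [Finset.mem_range] at hi
  exact L.proj_of_mem_ne (by omega) (hα _)

theorem proj_bracket_sum (l : ℤ) (p : ℕ) (X : 𝔥) {β : ℤ → 𝔥} (hβ : ∀ r, β r ∈ L.piece r) :
    (L.proj l (L.bracket X (∑ i ∈ Finset.range (p + 1), β ((i : ℤ) - 1))) : 𝔥)
      = ∑ i ∈ Finset.range (p + 1),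
        L.bracket (L.proj (l - ((i : ℤ) - 1)) X) (β ((i : ℤ) - 1)) := by
  rw [map_sum, map_sum, Submodule.coe_sum]
  exact Finset.sum_congr rfl fun i _ => L.proj_bracket _ _ _ (hβ _)

variable {α β : ℤ → 𝔥} (hα : ∀ r, α r ∈ L.piece r) (hβ : ∀ r, β r ∈ L.piece r)
include hα hβ

/-- Below degree `p - 1` the truncation of the sums at `p - 1` is not felt. -/
theorem proj_bracket_sum_sum_of_lt {p q : ℕ} (h : q < p) :
    (L.proj ((q : ℤ) - 1) (L.bracket (∑ i ∈ Finset.range (p + 1), α ((i : ℤ) - 1))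
        (∑ i ∈ Finset.range (p + 1), β ((i : ℤ) - 1))) : 𝔥)
      = ∑ r ∈ Finset.range q, L.bracket (α ((q : ℤ) - 1 - r)) (β r)
        + L.bracket (α (-1)) (β q) + L.bracket (α q) (β (-1)) := by
  rw [L.proj_bracket_sum _ _ _ hβ, ← Finset.sum_subset (Finset.range_subset_range.2
    (show q + 2 ≤ p + 1 by omega)), Finset.sum_range_succ', Finset.sum_range_succ]
  · have e : ∀ i ≤ q + 1, (L.proj ((q : ℤ) - 1 - ((i : ℤ) - 1))
        (∑ i ∈ Finset.range (p + 1), α ((i : ℤ) - 1)) : 𝔥) = α ((q : ℤ) - i) := by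
      intro i hi
      have h1 := L.proj_sum_of_le (p := p) (q := q + 1 - i) (by omega) hα
      rw [show (((q + 1 - i : ℕ) : ℤ) - 1) = (q : ℤ) - i by omega] at h1
      rw [show (q : ℤ) - 1 - ((i : ℤ) - 1) = q - i by ring]
      exact h1
    rw [e 0 (by omega), e (q + 1) le_rfl]
    congr 2
    · refine Finset.sum_congr rfl fun i hi => ?_
      rw [Finset.mem_range] at hi
      rw [e (i + 1) (by omega)]
      congr 2 <;> [skip; congr 1] <;> push_cast <;> ring_nf
    · congr 2 <;> [skip; congr 1] <;> push_cast <;> ring_nf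
  · intro i _ hi
    rw [Finset.mem_range] at hi
    rw [L.proj_sum_of_ne (Or.inl (by omega)) hα, map_zero, LinearMap.zero_apply]

/-- In degree `p - 1` the brackets with `α⁻¹` and `β⁻¹` are missing, since they would need terms of
degree `p`. -/
theorem proj_bracket_sum_sum_self (p : ℕ) :
    (L.proj ((p : ℤ) - 1) (L.bracket (∑ i ∈ Finset.range (p + 1), α ((i : ℤ) - 1))
        (∑ i ∈ Finset.range (p + 1), β ((i : ℤ) - 1))) : 𝔥)
      = ∑ r ∈ Finset.range p, L.bracket (α ((p : ℤ) - 1 - r)) (β r) := by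
  rw [L.proj_bracket_sum _ _ _ hβ, Finset.sum_range_succ',
    L.proj_sum_of_ne (Or.inr (by simp)) hα, map_zero, LinearMap.zero_apply, add_zero]
  refine Finset.sum_congr rfl fun i hi => ?_
  rw [Finset.mem_range] at hi
  have h1 := L.proj_sum_of_le (p := p) (q := p - i) (by omega) hα
  rw [show (((p - i : ℕ) : ℤ) - 1) = (p : ℤ) - 1 - i by omega] at h1
  rw [show (p : ℤ) - 1 - (((i + 1 : ℕ) : ℤ) - 1) = (p : ℤ) - 1 - i by push_cast; ring, h1]
  congr 2
  push_cast
  ring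

end Total

end GradedLie

/-! ### Tuples of two and three vectors -/

theorem removeNth_two {α : Type*} (u v : α) :
    Fin.removeNth (α := fun _ => α) 0 ![u, v] = ![v]
      ∧ Fin.removeNth (α := fun _ => α) 1 ![u, v] = ![u] := by
  constructor <;> · ext i; fin_cases i; rfl

theorem removeNth_three {α : Type*} (u v w : α) :
    Fin.removeNth (α := fun _ => α) 0 ![u, v, w] = ![v, w]
      ∧ Fin.removeNth (α := fun _ => α) 1 ![u, v, w] = ![u, w]
      ∧ Fin.removeNth (α := fun _ => α) 2 ![u, v, w] = ![u, v] := by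
  refine ⟨?_, ?_, ?_⟩ <;> · ext i; fin_cases i <;> rfl

theorem comp_vec_one {α β : Type*} (f : α → β) (u : α) : (fun i => f (![u] i)) = ![f u] := by
  ext i
  fin_cases i
  rfl

theorem comp_vec_two {α β : Type*} (f : α → β) (u v : α) :
    (fun i => f (![u, v] i)) = ![f u, f v] := by
  ext i
  fin_cases i <;> rfl

theorem alternatingMap_sum_apply {ι κ V F : Type*} [AddCommGroup V] [Module ℝ V] [AddCommGroup F]
    [Module ℝ F] (t : Finset κ) (c : κ → V [⋀^ι]→ₗ[ℝ] F) (v : ι → V) :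
    (∑ r ∈ t, c r) v = ∑ r ∈ t, c r v := by
  classical
  induction t using Finset.induction_on with
  | empty => simp
  | insert r t hr ih => simp [Finset.sum_insert hr, ih]

/-! ### Smoothness and the exterior derivative in charts -/

section Evaluation

variable {E' F : Type*} [NormedAddCommGroup E'] [NormedSpace ℝ E'] [NormedAddCommGroup F]
  [NormedSpace ℝ F]

theorem ContDiffOn.alternating_one_apply {a : E' → E' [⋀^Fin 1]→L[ℝ] F} {u : E' → E'} {O : Set E'}
    (ha : ContDiffOn ℝ ∞ a O) (hu : ContDiffOn ℝ ∞ u O) :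
    ContDiffOn ℝ ∞ (fun y => a y ![u y]) O := by
  have h : ContDiffOn ℝ ∞
      (fun y => (ContinuousAlternatingMap.ofSubsingletonLIE (𝕜 := ℝ) (E := E') (F := F)
        (0 : Fin 1)).symm (a y)) O :=
    (ContinuousAlternatingMap.ofSubsingletonLIE (𝕜 := ℝ) (E := E') (F := F)
        (0 : Fin 1)).symm.toContinuousLinearEquiv.contDiff.comp_contDiffOn ha
  refine (h.clm_apply hu).congr fun y _ => ?_
  change a y ![u y] = a y fun _ => u y
  congr 1
  ext i
  fin_cases i
  rfl

theorem ContDiffOn.alternating_two_apply {a : E' → E' [⋀^Fin 2]→L[ℝ] F} {u v : E' → E'}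
    {O : Set E'} (ha : ContDiffOn ℝ ∞ a O) (hu : ContDiffOn ℝ ∞ u O) (hv : ContDiffOn ℝ ∞ v O) :
    ContDiffOn ℝ ∞ (fun y => a y ![u y, v y]) O := by
  have hc : ContDiff ℝ ∞ (fun b : E' [⋀^Fin 2]→L[ℝ] F =>
      (ContinuousAlternatingMap.curryLeft b : E' →L[ℝ] E' [⋀^Fin 1]→L[ℝ] F)) :=
    IsBoundedLinearMap.contDiff ⟨⟨fun _ _ => rfl, fun _ _ => rfl⟩, 1, one_pos, fun b => by
      rw [one_mul]; exact (ContinuousAlternatingMap.norm_curryLeft b).le⟩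
  exact ((hc.comp_contDiffOn ha).clm_apply hu).alternating_one_apply hv

/-- A 1-form on a finite-dimensional space is smooth as soon as its values on constant vector
fields are. -/
theorem contDiffOn_alternating_one [FiniteDimensional ℝ E'] {a : E' → E' [⋀^Fin 1]→L[ℝ] F}
    {O : Set E'} (ha : ∀ v, ContDiffOn ℝ ∞ (fun y => a y ![v]) O) : ContDiffOn ℝ ∞ a O := by
  let e := ContinuousAlternatingMap.ofSubsingletonLIE (𝕜 := ℝ) (E := E') (F := F) (0 : Fin 1)
  have h : ContDiffOn ℝ ∞ (fun y => e.symm (a y)) O := by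
    refine contDiffOn_clm_apply.2 fun v => (ha v).congr fun y _ => ?_
    change (a y fun _ => v) = a y ![v]
    congr 1
    ext i
    fin_cases i
    rfl
  refine (e.toContinuousLinearEquiv.contDiff.comp_contDiffOn h).congr fun y _ => ?_
  exact (e.apply_symm_apply (a y)).symm

theorem ContDiffAt.extDeriv {q : ℕ} {a : E' → E' [⋀^Fin q]→L[ℝ] F} {y : E'}
    (ha : ContDiffAt ℝ ∞ a y) : ContDiffAt ℝ ∞ (extDeriv a) y :=
  ContDiff.comp_contDiffAt (g := ContinuousAlternatingMap.alternatizeUncurryFinCLM ℝ E' F (n := q))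
    y (ContinuousLinearMap.contDiff _) (ha.fderiv_right (m := ∞) (by simp))

theorem ContDiffOn.extDeriv {q : ℕ} {a : E' → E' [⋀^Fin q]→L[ℝ] F} {O : Set E'}
    (ha : ContDiffOn ℝ ∞ a O) (hO : IsOpen O) : ContDiffOn ℝ ∞ (extDeriv a) O := fun _ hy =>
  (ha.contDiffAt (hO.mem_nhds hy)).extDeriv.contDiffWithinAt

end Evaluation

section Charts

variable {n : ℕ} {M : Type*} [TopologicalSpace M] [ChartedSpace (EuclideanSpace ℝ (Fin n)) M]

/-- The part of the target of the chart around `x₀` that corresponds to `U`. -/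
def chartDomain (x₀ : M) (U : Set M) : Set (EuclideanSpace ℝ (Fin n)) :=
  (extChartAt (𝓡 n) x₀).target ∩ (extChartAt (𝓡 n) x₀).symm ⁻¹' U

theorem isOpen_chartDomain (x₀ : M) {U : Set M} (hU : IsOpen U) :
    IsOpen (chartDomain (n := n) x₀ U) :=
  (continuousOn_extChartAt_symm x₀).isOpen_inter_preimage (isOpen_extChartAt_target x₀) hU

theorem mem_chartDomain {x₀ : M} {U : Set M} (hx : x₀ ∈ U) :
    extChartAt (𝓡 n) x₀ x₀ ∈ chartDomain (n := n) x₀ U :=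
  ⟨mem_extChartAt_target x₀, by simpa using hx⟩

variable [IsManifold (𝓡 n) ∞ M]

theorem mdifferentiableAt_extChartAt_symm {x₀ : M} {y : EuclideanSpace ℝ (Fin n)}
    (hy : y ∈ (extChartAt (𝓡 n) x₀).target) :
    MDifferentiableAt 𝓘(ℝ, EuclideanSpace ℝ (Fin n)) (𝓡 n) (extChartAt (𝓡 n) x₀).symm y := by
  have : IsManifold (𝓡 n) 1 M := IsManifold.of_le (n := ∞) (by simp)
  exact ((mdifferentiableOn_extChartAt_symm (I := 𝓡 n) (x := x₀)) y hy).mdifferentiableAt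
    ((isOpen_extChartAt_target x₀).mem_nhds hy)

theorem mfderiv_extChartAt_symm_mfderiv_extChartAt {x₀ : M} {y : EuclideanSpace ℝ (Fin n)}
    (hy : y ∈ (extChartAt (𝓡 n) x₀).target)
    (v : TangentSpace (𝓡 n) ((extChartAt (𝓡 n) x₀).symm y)) :
    mfderiv 𝓘(ℝ, EuclideanSpace ℝ (Fin n)) (𝓡 n) (extChartAt (𝓡 n) x₀).symm y
      (mfderiv (𝓡 n) 𝓘(ℝ, EuclideanSpace ℝ (Fin n)) (extChartAt (𝓡 n) x₀)
        ((extChartAt (𝓡 n) x₀).symm y) v) = v := by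
  have : IsManifold (𝓡 n) 1 M := IsManifold.of_le (n := ∞) (by simp)
  have h := mfderivWithin_extChartAt_symm_comp_mfderiv_extChartAt (I := 𝓡 n) hy
  rw [ModelWithCorners.range_eq_univ, mfderivWithin_univ] at h
  exact congrArg (fun f => f v) h

namespace DiffForm

variable {q : ℕ} {F : Type*} [NormedAddCommGroup F] [NormedSpace ℝ F]

/-- The pull-back of a form on `M` under a map from the model space to `M`. -/
def pullback (η : DiffForm n M q F) (f : EuclideanSpace ℝ (Fin n) → M) :
    EuclideanSpace ℝ (Fin n) → EuclideanSpace ℝ (Fin n) [⋀^Fin q]→L[ℝ] F :=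
  fun y => (η (f y)).compContinuousLinearMap (mfderiv 𝓘(ℝ, EuclideanSpace ℝ (Fin n)) (𝓡 n) f y)

omit [IsManifold (𝓡 n) ∞ M] in
theorem pullback_congr (η : DiffForm n M q F) {f g : EuclideanSpace ℝ (Fin n) → M}
    {y : EuclideanSpace ℝ (Fin n)} (h : f =ᶠ[nhds y] g) : η.pullback f y = η.pullback g y := by
  have key : ∀ (a b : M) (_ : a = b) (A B : EuclideanSpace ℝ (Fin n) →L[ℝ]
      EuclideanSpace ℝ (Fin n)) (_ : A = B),
      ContinuousAlternatingMap.compContinuousLinearMap (M' := EuclideanSpace ℝ (Fin n)) (η a) A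
        = ContinuousAlternatingMap.compContinuousLinearMap (M' := EuclideanSpace ℝ (Fin n))
          (η b) B := by
    rintro a _ rfl A _ rfl
    rfl
  exact key _ _ h.eq_of_nhds _ _ h.mfderiv_eq

/-- The exterior derivative, which is defined at each point by the chart around that point, can be
computed in any chart. -/
theorem extDer_inChart {η : DiffForm n M q F} {U : Set M} (hU : IsOpen U) (hη : η.SmoothOn U)
    (x₀ : M) {y : EuclideanSpace ℝ (Fin n)} (hy : y ∈ chartDomain x₀ U) :
    η.extDer.inChart x₀ y = extDeriv (η.inChart x₀) y := by
  have h1 : IsManifold (𝓡 n) 1 M := IsManifold.of_le (n := ∞) (by simp)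
  let φ := extChartAt (𝓡 n) x₀
  let z : M := φ.symm y
  let φ' := extChartAt (𝓡 n) z
  let ψ : EuclideanSpace ℝ (Fin n) → EuclideanSpace ℝ (Fin n) := φ' ∘ φ.symm
  have hO : chartDomain (n := n) x₀ φ'.source ∈ nhds y :=
    (isOpen_chartDomain x₀ (isOpen_extChartAt_source z)).mem_nhds
      ⟨hy.1, mem_extChartAt_source z⟩
  have hψ : ContDiffOn ℝ ∞ ψ (chartDomain x₀ φ'.source) := by
    refine ContMDiffOn.contDiffOn ?_
    refine ContMDiffOn.comp (t := φ'.source) (I' := 𝓡 n) (fun w hw => ?_)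
      ((contMDiffOn_extChartAt_symm x₀).mono Set.inter_subset_left) fun w hw => hw.2
    exact (contMDiffAt_extChartAt' (by simpa [φ', extChartAt_source] using hw)).contMDiffWithinAt
  have hψy : ContDiffAt ℝ ∞ ψ y := hψ.contDiffAt hO
  -- Near `y` the two chart expressions differ by pull-back under the transition map `ψ`.
  have hloc : η.inChart x₀ =ᶠ[nhds y]
      fun w => (η.inChart z (ψ w)).compContinuousLinearMap (fderiv ℝ ψ w) := by
    filter_upwards [eventually_eventually_nhds.2 hO] with w hw
    have hw0 := hw.self_of_nhds
    have e : η.pullback φ.symm w = η.pullback (φ'.symm ∘ ψ) w := by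
      refine η.pullback_congr ?_
      filter_upwards [hw] with w' hw'
      exact (φ'.left_inv hw'.2).symm
    have hd : mfderiv 𝓘(ℝ, EuclideanSpace ℝ (Fin n)) (𝓡 n) (φ'.symm ∘ ψ) w
        = (mfderiv 𝓘(ℝ, EuclideanSpace ℝ (Fin n)) (𝓡 n) φ'.symm (ψ w)).comp
          (mfderiv 𝓘(ℝ, EuclideanSpace ℝ (Fin n)) 𝓘(ℝ, EuclideanSpace ℝ (Fin n)) ψ w) := by
      refine mfderiv_comp w (mdifferentiableAt_extChartAt_symm (φ'.map_source hw0.2)) ?_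
      exact ((hψ.contDiffAt hw).differentiableAt (by simp)).mdifferentiableAt
    change η.pullback φ.symm w = _
    rw [e]
    unfold pullback
    rw [hd, ← mfderiv_eq_fderiv]
    rfl
  have hz : z ∈ U := hy.2
  have hsm : DifferentiableAt ℝ (η.inChart z) (ψ y) :=
    ((hη z).contDiffAt ((isOpen_chartDomain z hU).mem_nhds (mem_chartDomain hz))).differentiableAt
      (by simp)
  have hsmooth : minSmoothness ℝ 2 ≤ ∞ := by
    rw [minSmoothness_of_isRCLikeNormedField]
    exact ENat.LEInfty.out
  rw [hloc.extDeriv_eq, extDeriv_pullback hsm hψy hsmooth]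
  have hd : fderiv ℝ ψ y = (mfderiv (𝓡 n) 𝓘(ℝ, EuclideanSpace ℝ (Fin n)) φ' z).comp
      (mfderiv 𝓘(ℝ, EuclideanSpace ℝ (Fin n)) (𝓡 n) φ.symm y) := by
    rw [← mfderiv_eq_fderiv]
    exact mfderiv_comp y (mdifferentiableAt_extChartAt (mem_chart_source _ z))
      (mdifferentiableAt_extChartAt_symm hy.1)
  rw [hd]
  rfl

end DiffForm

/-- A smooth vector field on `U` is smooth in each chart, because the trivialization of the tangent
bundle at `x₀` is the differential of the chart. -/
theorem contDiffOn_vectorField_inChart {U : Set M} (hU : IsOpen U)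
    {X : (x : M) → TangentSpace (𝓡 n) x}
    (hX : ContMDiffOn (𝓡 n) (𝓡 n).tangent ∞ (fun x => (⟨x, X x⟩ : TangentBundle (𝓡 n) M)) U)
    (x₀ : M) :
    ContDiffOn ℝ ∞ (fun y => (mfderiv (𝓡 n) 𝓘(ℝ, EuclideanSpace ℝ (Fin n)) (extChartAt (𝓡 n) x₀)
      ((extChartAt (𝓡 n) x₀).symm y) (X ((extChartAt (𝓡 n) x₀).symm y)) :
        EuclideanSpace ℝ (Fin n))) (chartDomain x₀ U) := by
  have h1 : IsManifold (𝓡 n) 1 M := IsManifold.of_le (n := ∞) (by simp)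
  let e := trivializationAt (EuclideanSpace ℝ (Fin n)) (TangentSpace (𝓡 n) (M := M)) x₀
  have hbase : e.baseSet = (chartAt (EuclideanSpace ℝ (Fin n)) x₀).source := rfl
  have h := (e.contMDiffOn_section_iff (IB := 𝓡 n) (n := ∞) (s := X) (hU.inter e.open_baseSet)
    Set.inter_subset_right).1 (hX.mono Set.inter_subset_left)
  have h' := h.comp ((contMDiffOn_extChartAt_symm (I := 𝓡 n) (n := ∞) x₀).mono
    (Set.inter_subset_left (t := (extChartAt (𝓡 n) x₀).symm ⁻¹' U))) (fun y hy => ⟨hy.2, by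
      rw [hbase, ← extChartAt_source (𝓡 n)]; exact (extChartAt (𝓡 n) x₀).map_target hy.1⟩)
  refine h'.contDiffOn.congr fun y hy => ?_
  have hs : (extChartAt (𝓡 n) x₀).symm y ∈ (chartAt (EuclideanSpace ℝ (Fin n)) x₀).source := by
    rw [← extChartAt_source (𝓡 n)]; exact (extChartAt (𝓡 n) x₀).map_target hy.1
  rw [← TangentBundle.continuousLinearMapAt_trivializationAt hs]
  exact e.continuousLinearMapAt_apply_of_mem ℝ hs _

end Charts

/-! ### The Bianchi identity on a vector space -/

section Bianchi

variable {E' 𝔤 : Type*} [NormedAddCommGroup E'] [NormedSpace ℝ E'] [NormedAddCommGroup 𝔤]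
  [NormedSpace ℝ 𝔤]

theorem extDeriv_two_apply {a : E' → E' [⋀^Fin 1]→L[ℝ] 𝔤} (y u v : E') :
    extDeriv a y ![u, v] = fderiv ℝ a y u ![v] - fderiv ℝ a y v ![u] := by
  simp [extDeriv, ContinuousAlternatingMap.alternatizeUncurryFin_apply, Fin.sum_univ_two,
    (removeNth_two u v).1, (removeNth_two u v).2, sub_eq_add_neg]

theorem extDeriv_three_apply {b : E' → E' [⋀^Fin 2]→L[ℝ] 𝔤} (y u v w : E') :
    extDeriv b y ![u, v, w]
      = fderiv ℝ b y u ![v, w] - fderiv ℝ b y v ![u, w] + fderiv ℝ b y w ![u, v] := by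
  simp [extDeriv, ContinuousAlternatingMap.alternatizeUncurryFin_apply, Fin.sum_univ_three,
    (removeNth_three u v w).1, (removeNth_three u v w).2.1, (removeNth_three u v w).2.2,
    sub_eq_add_neg]

/-- The value on `u`, `v` of the curvature `da + ½[a, a]` of a 1-form `a`. -/
def curv (B : 𝔤 →L[ℝ] 𝔤 →L[ℝ] 𝔤) (a : E' → E' [⋀^Fin 1]→L[ℝ] 𝔤) (u v y : E') : 𝔤 :=
  extDeriv a y ![u, v] + B (a y ![u]) (a y ![v])

theorem hasFDerivAt_alternating_apply {ι : Type*} [Fintype ι] {b : E' → E' [⋀^ι]→L[ℝ] 𝔤} {y : E'}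
    (hb : DifferentiableAt ℝ b y) (u : ι → E') :
    HasFDerivAt (fun z => b z u)
      ((ContinuousAlternatingMap.apply ℝ E' 𝔤 u).comp (fderiv ℝ b y)) y :=
  (ContinuousAlternatingMap.apply ℝ E' 𝔤 u).hasFDerivAt.comp y hb.hasFDerivAt

theorem hasFDerivAt_curv (B : 𝔤 →L[ℝ] 𝔤 →L[ℝ] 𝔤) {a : E' → E' [⋀^Fin 1]→L[ℝ] 𝔤} {y : E'}
    (ha : DifferentiableAt ℝ a y) (hda : DifferentiableAt ℝ (extDeriv a) y) (u v : E') :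
    HasFDerivAt (curv B a u v)
      ((ContinuousAlternatingMap.apply ℝ E' 𝔤 ![u, v]).comp (fderiv ℝ (extDeriv a) y)
        + (B.precompR E' (a y ![u])
            ((ContinuousAlternatingMap.apply ℝ E' 𝔤 ![v]).comp (fderiv ℝ a y))
          + B.precompL E' ((ContinuousAlternatingMap.apply ℝ E' 𝔤 ![u]).comp (fderiv ℝ a y))
            (a y ![v]))) y :=
  (hasFDerivAt_alternating_apply hda _).add
    (B.hasFDerivAt_of_bilinear (hasFDerivAt_alternating_apply ha _)
      (hasFDerivAt_alternating_apply ha _))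

theorem fderiv_curv_apply (B : 𝔤 →L[ℝ] 𝔤 →L[ℝ] 𝔤) {a : E' → E' [⋀^Fin 1]→L[ℝ] 𝔤} {y : E'}
    (ha : DifferentiableAt ℝ a y) (hda : DifferentiableAt ℝ (extDeriv a) y) (u v w : E') :
    fderiv ℝ (curv B a u v) y w = fderiv ℝ (extDeriv a) y w ![u, v]
      + (B (a y ![u]) (fderiv ℝ a y w ![v]) + B (fderiv ℝ a y w ![u]) (a y ![v])) := by
  rw [(hasFDerivAt_curv B ha hda u v).fderiv]
  rfl

/-- The Bianchi identity `dΩ = [Ω, a]` for the curvature `Ω = da + ½[a, a]`. -/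
theorem bianchi (B : 𝔤 →L[ℝ] 𝔤 →L[ℝ] 𝔤) (hB : ∀ X Y, B X Y = -B Y X)
    (hJ : ∀ X Y Z, B (B X Y) Z + B (B Y Z) X + B (B Z X) Y = 0)
    {a : E' → E' [⋀^Fin 1]→L[ℝ] 𝔤} {y : E'} (ha : ContDiffAt ℝ ∞ a y) (u v w : E') :
    fderiv ℝ (curv B a u v) y w + fderiv ℝ (curv B a v w) y u + fderiv ℝ (curv B a w u) y v
      = B (curv B a u v y) (a y ![w]) + B (curv B a v w y) (a y ![u])
        + B (curv B a w u y) (a y ![v]) := by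
  have hd : DifferentiableAt ℝ a y := ha.differentiableAt (by simp)
  have hda : DifferentiableAt ℝ (extDeriv a) y := ha.extDeriv.differentiableAt (by simp)
  have hdd : extDeriv (extDeriv a) y = 0 := extDeriv_extDeriv_apply ha (by
    rw [minSmoothness_of_isRCLikeNormedField]
    exact ENat.LEInfty.out)
  have h3 : fderiv ℝ (extDeriv a) y u ![v, w] + fderiv ℝ (extDeriv a) y v ![w, u]
      + fderiv ℝ (extDeriv a) y w ![u, v] = 0 := by
    have h := extDeriv_three_apply (b := extDeriv a) y u v w
    have hs : fderiv ℝ (extDeriv a) y v ![w, u] = -fderiv ℝ (extDeriv a) y v ![u, w] := by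
      refine Eq.trans (congrArg _ ?_)
        ((fderiv ℝ (extDeriv a) y v).toAlternatingMap.map_swap ![u, w] (i := 0) (j := 1) (by simp))
      ext i
      fin_cases i <;> simp
    rw [hdd] at h
    rw [hs]
    simpa [sub_eq_add_neg] using h.symm
  rw [fderiv_curv_apply B hd hda, fderiv_curv_apply B hd hda, fderiv_curv_apply B hd hda]
  simp only [curv, extDeriv_two_apply, map_add, map_sub, add_apply, sub_apply]
  have hj := hJ (a y ![u]) (a y ![v]) (a y ![w])
  rw [hB (a y ![u]) (fderiv ℝ a y w ![v]), hB (a y ![v]) (fderiv ℝ a y u ![w]),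
    hB (a y ![w]) (fderiv ℝ a y v ![u])]
  linear_combination (norm := module) h3 - hj

end Bianchi

/-! ### The total form of an admissible tuple and its curvature -/

section Homogeneous

variable {n m k : ℕ} {𝔥 : Type*} [NormedAddCommGroup 𝔥] [NormedSpace ℝ 𝔥]
  {E : Type*} [NormedAddCommGroup E] [NormedSpace ℝ E] [FiniteDimensional ℝ E]
  {H : Type*} [TopologicalSpace H] [ChartedSpace E H] [Group H] [LieGroup 𝓘(ℝ, E) ∞ H]
  {N : Type*} [TopologicalSpace N] [ChartedSpace (EuclideanSpace ℝ (Fin (n + m))) N]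
  [IsManifold (𝓡 (n + m)) ∞ N] [MulAction H N] [ContMDiffSMul 𝓘(ℝ, E) (𝓡 (n + m)) ∞ H N]

namespace FlatReductive

variable (S : FlatReductive n m k 𝔥 E H N)

include S in
theorem finiteDimensional : FiniteDimensional ℝ 𝔥 := by
  have : FiniteDimensional ℝ (GroupLieAlgebra 𝓘(ℝ, E) H) := inferInstanceAs (FiniteDimensional ℝ E)
  exact S.lieEquiv.symm.finiteDimensional

/-- The identification `𝔥⁻¹ → V` is injective: its kernel is `𝔥⁻¹ ∩ (𝔥⁰ ⊕ ⋯ ⊕ 𝔥ᵏ⁻¹)`. -/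
theorem coord_injective : Function.Injective S.coord := by
  rw [← LinearMap.ker_eq_bot, LinearMap.ker_eq_bot']
  intro X hX
  have h0 : orbitDeriv (n + m) H S.base (S.lieEquiv X) = 0 :=
    S.frame.equivFun.map_eq_zero_iff.1 hX
  have h1 := (S.isotropy X).1 h0
  have hd := S.lie.isInternal.submodule_iSupIndep (-1)
  have h2 : (⨆ p : ℕ, S.lie.piece (p : ℤ)) ≤ ⨆ (j : ℤ) (_ : j ≠ -1), S.lie.piece j :=
    iSup_le fun p => le_iSup₂_of_le (p : ℤ) (by omega) le_rfl
  exact Subtype.ext (Submodule.disjoint_def.1 hd X X.2 (h2 h1))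

/-- The bracket of `𝔥` as a continuous bilinear map. -/
def bracketCLM : 𝔥 →L[ℝ] 𝔥 →L[ℝ] 𝔥 :=
  have := S.finiteDimensional
  LinearMap.toContinuousLinearMap
    ((LinearMap.toContinuousLinearMap : (𝔥 →ₗ[ℝ] 𝔥) ≃ₗ[ℝ] 𝔥 →L[ℝ] 𝔥).toLinearMap ∘ₗ S.lie.bracket)

theorem bracketCLM_apply (X Y : 𝔥) : S.bracketCLM X Y = S.lie.bracket X Y := rfl

section Curvature

variable {S} {M : Type*} [TopologicalSpace M] [ChartedSpace (EuclideanSpace ℝ (Fin n)) M]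

theorem FormFamily.coe_bracket_apply (η : S.FormFamily M) {i j l : ℤ} (h : i + j = l) (x : M)
    (u v : TangentSpace (𝓡 n) x) :
    (η.bracket i j l x ![u, v] : 𝔥)
      = S.lie.bracket (η i x ![u]) (η j x ![v]) - S.lie.bracket (η i x ![v]) (η j x ![u]) := by
  unfold FormFamily.bracket
  rw [wedgeBilin_apply, Submodule.coe_sub, S.lie.coe_bracketProj h, S.lie.coe_bracketProj h]
  rfl

/-- The term `½[ω⁻¹, ω⁻¹]` vanishes since `𝔥⁻² = 0`, and the factor `½` is absorbed by the symmetry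
`r ↔ q - 1 - r` of the sum. -/
theorem FormFamily.curvature_apply (η : S.FormFamily M) (q : ℕ) (x : M)
    (u v : TangentSpace (𝓡 n) x) :
    (η.curvature q x ![u, v] : 𝔥) = ((η ((q : ℤ) - 1)).extDer x ![u, v] : 𝔥)
      + ∑ r ∈ Finset.range q,
        S.lie.bracket (η ((q : ℤ) - 1 - r) x ![u]) (η (r : ℤ) x ![v]) := by
  have h0 : η.bracket (-1) (-1) ((q : ℤ) - 1) x ![u, v] = 0 := by
    unfold FormFamily.bracket
    rw [wedgeBilin_apply, S.lie.bracketProj_neg_one, S.lie.bracketProj_neg_one, sub_zero]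
  have h1 : ∑ r ∈ Finset.range q,
        S.lie.bracket (η (r : ℤ) x ![u]) (η ((q : ℤ) - 1 - r) x ![v])
      = ∑ r ∈ Finset.range q,
        S.lie.bracket (η ((q : ℤ) - 1 - r) x ![u]) (η (r : ℤ) x ![v]) := by
    rw [← Finset.sum_range_reflect]
    refine Finset.sum_congr rfl fun r hr => ?_
    rw [Finset.mem_range] at hr
    have e1 : ((q - 1 - r : ℕ) : ℤ) = (q : ℤ) - 1 - r := by omega
    have e2 : (q : ℤ) - 1 - ((q : ℤ) - 1 - r) = r := by ring
    rw [e1, e2]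
  have h2 : ∀ r : ℕ, (η.bracket (r : ℤ) ((q : ℤ) - 1 - r) ((q : ℤ) - 1) x ![u, v] : 𝔥)
      = S.lie.bracket (η (r : ℤ) x ![u]) (η ((q : ℤ) - 1 - r) x ![v])
        + S.lie.bracket (η ((q : ℤ) - 1 - r) x ![u]) (η (r : ℤ) x ![v]) := by
    intro r
    rw [η.coe_bracket_apply (by ring), S.lie.bracket_swap (η (r : ℤ) x ![v]), sub_neg_eq_add]
  simp only [FormFamily.curvature, AlternatingMap.add_apply, AlternatingMap.smul_apply,
    alternatingMap_sum_apply, h0, smul_zero, add_zero, Submodule.coe_add, Submodule.coe_smul,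
    Submodule.coe_sum, h2, Finset.sum_add_distrib, h1]
  rw [← two_smul ℝ (∑ r ∈ Finset.range q, _), smul_smul]
  norm_num

/-- The `𝔥`-valued 1-form `ω⁻¹ + ω⁰ + ⋯ + ω^{p-1}`. -/
def FormFamily.total (η : S.FormFamily M) (p : ℕ) : DiffForm n M 1 𝔥 := fun x =>
  ∑ i ∈ Finset.range (p + 1),
    (S.lie.piece ((i : ℤ) - 1)).subtypeL.compContinuousAlternatingMap (η ((i : ℤ) - 1) x)

theorem FormFamily.total_apply (η : S.FormFamily M) (p : ℕ) (x : M) (u : TangentSpace (𝓡 n) x) :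
    η.total p x ![u] = ∑ i ∈ Finset.range (p + 1), (η ((i : ℤ) - 1) x ![u] : 𝔥) := by
  rw [FormFamily.total, ContinuousAlternatingMap.sum_apply]
  rfl

theorem FormFamily.total_inChart (η : S.FormFamily M) (p : ℕ) (x₀ : M) :
    (η.total p).inChart x₀ = fun y => ∑ i ∈ Finset.range (p + 1),
      ContinuousLinearMap.compContinuousAlternatingMapCLM ℝ (EuclideanSpace ℝ (Fin n))
        (S.lie.piece ((i : ℤ) - 1)) 𝔥 (Fin 1) (S.lie.piece ((i : ℤ) - 1)).subtypeL
        ((η ((i : ℤ) - 1)).inChart x₀ y) := by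
  ext y v
  rw [ContinuousAlternatingMap.sum_apply]
  change (η.total p _) _ = _
  rw [FormFamily.total, ContinuousAlternatingMap.sum_apply]
  rfl

/-- The value on `u`, `v` of the curvature `dω + ½[ω, ω]` of `ω = ω⁻¹ + ⋯ + ω^{p-1}`. -/
def FormFamily.totalCurv (η : S.FormFamily M) (p : ℕ) (x : M) (u v : TangentSpace (𝓡 n) x) : 𝔥 :=
  ∑ i ∈ Finset.range (p + 1), ((η ((i : ℤ) - 1)).extDer x ![u, v] : 𝔥)
    + S.lie.bracket (η.total p x ![u]) (η.total p x ![v])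

/-- The components of low degree of the curvature of `ω` are the defects of the structure equations
of an admissible tuple. -/
theorem FormFamily.proj_totalCurv_of_lt (η : S.FormFamily M) {p q : ℕ} (h : q < p) (x : M)
    (u v : TangentSpace (𝓡 n) x) :
    (S.lie.proj ((q : ℤ) - 1) (η.totalCurv p x u v) : 𝔥)
      = (η.curvature q x ![u, v] : 𝔥) + η.bracket (-1) (q : ℤ) ((q : ℤ) - 1) x ![u, v] := by
  rw [FormFamily.totalCurv, map_add, Submodule.coe_add, η.total_apply, η.total_apply,
    S.lie.proj_sum_of_le h.le (α := fun r => ((η r).extDer x ![u, v] : 𝔥))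
      fun r => Subtype.coe_prop _,
    S.lie.proj_bracket_sum_sum_of_lt (α := fun r => (η r x ![u] : 𝔥))
      (β := fun r => (η r x ![v] : 𝔥)) (fun r => Subtype.coe_prop _) (fun r => Subtype.coe_prop _) h,
    η.curvature_apply, η.coe_bracket_apply (by ring), S.lie.bracket_swap (η (-1) x ![v])]
  abel

/-- The first component that the structure equations leave free is the curvature of order `p + 1`. -/
theorem FormFamily.proj_totalCurv_self (η : S.FormFamily M) (p : ℕ) (x : M)
    (u v : TangentSpace (𝓡 n) x) :
    (S.lie.proj ((p : ℤ) - 1) (η.totalCurv p x u v) : 𝔥) = η.curvature p x ![u, v] := by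
  rw [FormFamily.totalCurv, map_add, Submodule.coe_add, η.total_apply, η.total_apply,
    S.lie.proj_sum_of_le le_rfl (α := fun r => ((η r).extDer x ![u, v] : 𝔥))
      fun r => Subtype.coe_prop _,
    S.lie.proj_bracket_sum_sum_self (α := fun r => (η r x ![u] : 𝔥))
      (β := fun r => (η r x ![v] : 𝔥)) (fun r => Subtype.coe_prop _) (fun r => Subtype.coe_prop _),
    η.curvature_apply]

end Curvature

/-! ### The Bianchi identity of an admissible tuple -/

section Immersion

variable {S : FlatReductive n m k 𝔥 E H N} {M : Type*} [TopologicalSpace M]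
  [ChartedSpace (EuclideanSpace ℝ (Fin n)) M]

/-- The tangent vector with coordinates `u` at the point with coordinates `y` in the chart around
`x₀`. -/
def chartVec (x₀ : M) (y : EuclideanSpace ℝ (Fin n)) :
    EuclideanSpace ℝ (Fin n) →L[ℝ] TangentSpace (𝓡 n) ((extChartAt (𝓡 n) x₀).symm y) :=
  mfderiv 𝓘(ℝ, EuclideanSpace ℝ (Fin n)) (𝓡 n) (extChartAt (𝓡 n) x₀).symm y

theorem inChart_apply_one {F : Type*} [NormedAddCommGroup F] [NormedSpace ℝ F]
    (ζ : DiffForm n M 1 F) (x₀ : M) (y u : EuclideanSpace ℝ (Fin n)) :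
    ζ.inChart x₀ y ![u] = ζ ((extChartAt (𝓡 n) x₀).symm y) ![chartVec x₀ y u] :=
  congrArg (ζ ((extChartAt (𝓡 n) x₀).symm y)) (comp_vec_one (chartVec x₀ y) u)

theorem inChart_apply_two {F : Type*} [NormedAddCommGroup F] [NormedSpace ℝ F]
    (ζ : DiffForm n M 2 F) (x₀ : M) (y u v : EuclideanSpace ℝ (Fin n)) :
    ζ.inChart x₀ y ![u, v]
      = ζ ((extChartAt (𝓡 n) x₀).symm y) ![chartVec x₀ y u, chartVec x₀ y v] :=
  congrArg (ζ ((extChartAt (𝓡 n) x₀).symm y)) (comp_vec_two (chartVec x₀ y) u v)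

theorem FormFamily.contDiffOn_total_inChart {η : S.FormFamily M} {p : ℕ} {U : Set M}
    (hη : ∀ r : ℤ, -1 ≤ r → r ≤ (p : ℤ) - 1 → (η r).SmoothOn U) (x₀ : M) :
    ContDiffOn ℝ ∞ ((η.total p).inChart x₀) (chartDomain x₀ U) := by
  rw [η.total_inChart]
  refine ContDiffOn.sum fun i hi => ?_
  rw [Finset.mem_range] at hi
  exact (ContinuousLinearMap.contDiff _).comp_contDiffOn (hη _ (by omega) (by omega) x₀)

variable [IsManifold (𝓡 n) ∞ M]

/-- The curvature of the total form, read in a chart. -/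
theorem FormFamily.curv_total_inChart {η : S.FormFamily M} {p : ℕ} {U : Set M} (hU : IsOpen U)
    (hη : ∀ r : ℤ, -1 ≤ r → r ≤ (p : ℤ) - 1 → (η r).SmoothOn U) (x₀ : M)
    {y : EuclideanSpace ℝ (Fin n)} (hy : y ∈ chartDomain x₀ U) (u v : EuclideanSpace ℝ (Fin n)) :
    curv S.bracketCLM ((η.total p).inChart x₀) u v y
      = η.totalCurv p ((extChartAt (𝓡 n) x₀).symm y)
        (chartVec x₀ y u) (chartVec x₀ y v) := by
  have hnhds := (isOpen_chartDomain (n := n) x₀ hU).mem_nhds hy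
  have hd : ∀ i ∈ Finset.range (p + 1),
      HasFDerivAt (fun z => ContinuousLinearMap.compContinuousAlternatingMapCLM ℝ
          (EuclideanSpace ℝ (Fin n)) (S.lie.piece ((i : ℤ) - 1)) 𝔥 (Fin 1)
          (S.lie.piece ((i : ℤ) - 1)).subtypeL ((η ((i : ℤ) - 1)).inChart x₀ z))
        ((ContinuousLinearMap.compContinuousAlternatingMapCLM ℝ
          (EuclideanSpace ℝ (Fin n)) (S.lie.piece ((i : ℤ) - 1)) 𝔥 (Fin 1)
          (S.lie.piece ((i : ℤ) - 1)).subtypeL).comp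
            (fderiv ℝ ((η ((i : ℤ) - 1)).inChart x₀) y)) y := by
    intro i hi
    rw [Finset.mem_range] at hi
    exact (ContinuousLinearMap.hasFDerivAt _).comp y
      (((hη _ (by omega) (by omega) x₀).contDiffAt hnhds).differentiableAt
        (by simp)).hasFDerivAt
  have h1 : extDeriv ((η.total p).inChart x₀) y ![u, v]
      = ∑ i ∈ Finset.range (p + 1),
        (extDeriv ((η ((i : ℤ) - 1)).inChart x₀) y ![u, v] : 𝔥) := by
    rw [extDeriv_two_apply, η.total_inChart, (HasFDerivAt.fun_sum hd).fderiv]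
    simp only [extDeriv_two_apply, Submodule.coe_sub, Finset.sum_sub_distrib,
      _root_.sum_apply, ContinuousAlternatingMap.sum_apply]
    rfl
  unfold curv FormFamily.totalCurv
  rw [h1, inChart_apply_one, inChart_apply_one, S.bracketCLM_apply]
  congr 1
  refine Finset.sum_congr rfl fun i hi => ?_
  rw [Finset.mem_range] at hi
  rw [← DiffForm.extDer_inChart hU (hη _ (by omega) (by omega)) x₀ hy, inChart_apply_two]

variable {G : Subgroup (Matrix.GeneralLinearGroup (Fin n) ℝ)} {P : GStructure G M}
  {U : Set M} {s : (x : M) → Module.Basis (Fin n) ℝ (TangentSpace (𝓡 n) x)} {η : S.FormFamily M}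

theorem IsAdmissible.proj_totalCurv_eq_zero {p : ℕ} (h : S.IsAdmissible P p U s η) {q : ℕ}
    (hq : q < p) {x : M} (hx : x ∈ U) (u v : TangentSpace (𝓡 n) x) :
    (S.lie.proj ((q : ℤ) - 1) (η.totalCurv p x u v) : 𝔥) = 0 := by
  rw [η.proj_totalCurv_of_lt hq, h.structure_eq q hq x hx, AlternatingMap.neg_apply]
  simp

/-- All components of the curvature below degree `p` vanish, so only its component of degree `p`
and `ω⁻¹` contribute to the component of degree `p - 1` of `[Ω, ω]`. -/
theorem IsAdmissible.proj_bracket_totalCurv {p : ℕ} (h : S.IsAdmissible P (p + 1) U s η)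
    {x : M} (hx : x ∈ U) (u v w : TangentSpace (𝓡 n) x) :
    (S.lie.proj ((p : ℤ) - 1) (S.lie.bracket (η.totalCurv (p + 1) x u v) (η.total (p + 1) x ![w]))
        : 𝔥)
      = S.lie.bracket (η.curvature (p + 1) x ![u, v]) (η (-1) x ![w]) := by
  rw [η.total_apply, S.lie.proj_bracket_sum _ _ _ (β := fun r => (η r x ![w] : 𝔥))
    fun r => Subtype.coe_prop _, Finset.sum_eq_single 0]
  · have e : (p : ℤ) - 1 - (((0 : ℕ) : ℤ) - 1) = ((p + 1 : ℕ) : ℤ) - 1 := by push_cast; ring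
    rw [e, η.proj_totalCurv_self]
    rfl
  · intro i hi h0
    rw [Finset.mem_range] at hi
    have e : (p : ℤ) - 1 - ((i : ℤ) - 1) = ((p + 1 - i : ℕ) : ℤ) - 1 := by omega
    rw [e, h.proj_totalCurv_eq_zero (by omega) hx, map_zero, LinearMap.zero_apply]
  · intro h0
    exact absurd (Finset.mem_range.2 (Nat.succ_pos _)) h0

/-- The component of degree `p - 1` of the Bianchi identity: `[Ωᵖ, ω⁻¹] = 0` for the curvature `Ωᵖ`
of an admissible tuple of order `p + 1`. -/
theorem IsAdmissible.curvature_bianchi {p : ℕ} (h : S.IsAdmissible P (p + 1) U s η)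
    {x : M} (hx : x ∈ U) (u v w : TangentSpace (𝓡 n) x) :
    S.lie.bracket (η.curvature (p + 1) x ![u, v]) (η (-1) x ![w])
      + S.lie.bracket (η.curvature (p + 1) x ![v, w]) (η (-1) x ![u])
      + S.lie.bracket (η.curvature (p + 1) x ![w, u]) (η (-1) x ![v]) = 0 := by
  -- The base point of the chart is decoupled from `x`, so that `x` can be written in coordinates.
  have key : ∀ x₀ : M, ∀ x ∈ U, x ∈ (extChartAt (𝓡 n) x₀).source →
      ∀ u v w : TangentSpace (𝓡 n) x,
      S.lie.bracket (η.curvature (p + 1) x ![u, v]) (η (-1) x ![w])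
        + S.lie.bracket (η.curvature (p + 1) x ![v, w]) (η (-1) x ![u])
        + S.lie.bracket (η.curvature (p + 1) x ![w, u]) (η (-1) x ![v]) = 0 := by
    intro x₀ x hx hs
    obtain ⟨y, hy, rfl⟩ : ∃ y ∈ (extChartAt (𝓡 n) x₀).target, (extChartAt (𝓡 n) x₀).symm y = x :=
      ⟨_, (extChartAt (𝓡 n) x₀).map_source hs, (extChartAt (𝓡 n) x₀).left_inv hs⟩
    have hyU : y ∈ chartDomain x₀ U := ⟨hy, hx⟩
    have hO := isOpen_chartDomain (n := n) x₀ h.isOpen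
    let D := chartVec (n := n) x₀ y
    have hsurj : ∀ u, ∃ u', D u' = u :=
      fun u => ⟨_, mfderiv_extChartAt_symm_mfderiv_extChartAt hy u⟩
    intro u v w
    obtain ⟨u, rfl⟩ := hsurj u
    obtain ⟨v, rfl⟩ := hsurj v
    obtain ⟨w, rfl⟩ := hsurj w
    let a := (η.total (p + 1)).inChart x₀
    have ha : ContDiffAt ℝ ∞ a y :=
      (FormFamily.contDiffOn_total_inChart h.smooth x₀).contDiffAt (hO.mem_nhds hyU)
    have : FiniteDimensional ℝ 𝔥 := S.finiteDimensional
    let π : 𝔥 →L[ℝ] S.lie.piece ((p : ℤ) - 1) :=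
      LinearMap.toContinuousLinearMap (S.lie.proj ((p : ℤ) - 1))
    have hda : DifferentiableAt ℝ (extDeriv a) y := ha.extDeriv.differentiableAt (by simp)
    have hzero : ∀ u v w : EuclideanSpace ℝ (Fin n),
        π (fderiv ℝ (curv S.bracketCLM a u v) y w) = 0 := by
      intro u v w
      have h0 : (fun z => π (curv S.bracketCLM a u v z)) =ᶠ[nhds y]
          fun _ => (0 : S.lie.piece ((p : ℤ) - 1)) := by
        filter_upwards [hO.mem_nhds hyU] with z hz
        rw [FormFamily.curv_total_inChart h.isOpen h.smooth x₀ hz]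
        have h0 := h.proj_totalCurv_eq_zero p.lt_succ_self hz.2 (chartVec x₀ z u) (chartVec x₀ z v)
        exact Subtype.ext h0
      have h2 : HasFDerivAt (fun z => π (curv S.bracketCLM a u v z))
          (π.comp (fderiv ℝ (curv S.bracketCLM a u v) y)) y :=
        π.hasFDerivAt.comp y (hasFDerivAt_curv S.bracketCLM (ha.differentiableAt (by simp)) hda u
          v).differentiableAt.hasFDerivAt
      have h3 := h0.fderiv_eq (𝕜 := ℝ)
      rw [fderiv_fun_const] at h3
      exact congrArg (fun f => f w) (h2.fderiv.symm.trans h3)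
    have hB := congrArg (fun X => (π X : 𝔥)) (bianchi S.bracketCLM S.lie.bracket_swap
      S.lie.jacobi_cyclic ha u v w)
    have ht : ∀ u v w : EuclideanSpace ℝ (Fin n),
        (π (S.bracketCLM (curv S.bracketCLM a u v y) (a y ![w])) : 𝔥)
        = S.lie.bracket (η.curvature (p + 1) ((extChartAt (𝓡 n) x₀).symm y) ![D u, D v])
          (η (-1) ((extChartAt (𝓡 n) x₀).symm y) ![D w]) := by
      intro u v w
      rw [FormFamily.curv_total_inChart h.isOpen h.smooth x₀ hyU,
        ← h.proj_bracket_totalCurv hx (D u) (D v) (D w), inChart_apply_one]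
      rfl
    simp only [map_add, hzero, Submodule.coe_add, ht] at hB
    rw [← hB]
    simp
  exact key x x hx (mem_extChartAt_source x) u v w

/-- The soldering form inverts the identification of `W` with the tangent space. -/
theorem IsAdmissible.soldering_frameMap {p : ℕ} (h : S.IsAdmissible P p U s η) {x : M}
    (hx : x ∈ U) (w : S.W) : η (-1) x ![S.frameMap (s x) w] = w := by
  refine S.coord_injective ?_
  rw [h.soldering x hx]
  ext j
  rcases j with i | j
  · have : S.frameMap (s x) w = (s x).equivFun.symm fun i => S.coord w (Sum.inl i) := rfl
    rw [Sum.elim_inl, this, ← (s x).equivFun_apply, LinearEquiv.apply_symm_apply]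
  · exact (w.2 j).symm

/-- The curvatures of all levels are cocycles. -/
theorem IsAdmissible.curvatureCochain_mem_cocycles {p : ℕ} (h : S.IsAdmissible P p U s η) {x : M}
    (hx : x ∈ U) (r : ℕ) (hr : r ≤ p) :
    η.curvatureCochain r p (s x) ∈ S.lie.cocycles S.W r p hr 2 := by
  cases p with
  | zero => exact Submodule.mem_top
  | succ p =>
    change S.lie.spencer S.W r p 2 hr _ = 0
    ext v
    change -(alternate (S.lie.coeffBracket S.W r p hr) (η.curvatureCochain r (p + 1) (s x))) v = 0
    rw [neg_eq_zero, alternate_apply]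
    have hc : ∀ a b c : S.W, S.lie.coeffBracket S.W r p hr c
        (η.curvatureCochain r (p + 1) (s x) ![a, b])
        = S.lie.toCoeff S.W r p (S.lie.bracketRight S.W p c
          (η.curvature (p + 1) x ![S.frameMap (s x) a, S.frameMap (s x) b])) := by
      intro a b c
      rw [← comp_vec_two (S.frameMap (s x))]
      rfl
    obtain ⟨a, b, c, rfl⟩ : ∃ a b c, v = ![a, b, c] :=
      ⟨v 0, v 1, v 2, by ext i; fin_cases i <;> rfl⟩
    have e : ∀ X Y Z : S.lie.Coeff S.W r p, (-1 : ℤ) ^ ((0 : Fin 3) : ℕ) • X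
        + (-1 : ℤ) ^ ((1 : Fin 3) : ℕ) • Y + (-1 : ℤ) ^ ((2 : Fin 3) : ℕ) • Z = X - Y + Z := by
      intro X Y Z
      simp [sub_eq_add_neg]
    rw [Fin.sum_univ_three, e, (removeNth_three a b c).1, (removeNth_three a b c).2.1,
      (removeNth_three a b c).2.2, hc, hc, hc, ← map_sub, ← map_add]
    refine (congrArg _ (Subtype.ext ?_)).trans (map_zero _)
    have hb := h.curvature_bianchi hx (S.frameMap (s x) a) (S.frameMap (s x) b)
      (S.frameMap (s x) c)
    rw [h.soldering_frameMap hx, h.soldering_frameMap hx, h.soldering_frameMap hx] at hb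
    have hs : (η.curvature (p + 1) x ![S.frameMap (s x) c, S.frameMap (s x) a])
        = -(η.curvature (p + 1) x ![S.frameMap (s x) a, S.frameMap (s x) c]) := by
      refine Eq.trans (congrArg _ ?_) ((η.curvature (p + 1) x).map_swap
        ![S.frameMap (s x) a, S.frameMap (s x) c] (i := 0) (j := 1) (by simp))
      ext i
      fin_cases i <;> simp
    rw [hs] at hb
    rw [Submodule.coe_add, Submodule.coe_sub, S.lie.coe_bracketRight, S.lie.coe_bracketRight,
      S.lie.coe_bracketRight, Submodule.coe_zero, ← hb, Submodule.coe_neg, map_neg,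
      LinearMap.neg_apply]
    change S.lie.bracket _ (a : S.lie.piece (-1)) - S.lie.bracket _ (b : S.lie.piece (-1))
      + S.lie.bracket _ (c : S.lie.piece (-1)) = _
    abel

end Immersion

/-! ### Coboundaries and the extension of admissible tuples -/

section Extension

variable {S : FlatReductive n m k 𝔥 E H N} {M : Type*} [TopologicalSpace M]
  [ChartedSpace (EuclideanSpace ℝ (Fin n)) M]

theorem curvatureCochain_apply_two (η : S.FormFamily M) (r p : ℕ) {x : M}
    (u : Module.Basis (Fin n) ℝ (TangentSpace (𝓡 n) x)) (a b : S.W) :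
    η.curvatureCochain r p u ![a, b]
      = S.lie.toCoeff S.W r p (η.curvature p x ![S.frameMap u a, S.frameMap u b]) := by
  rw [← comp_vec_two (S.frameMap u)]
  rfl

theorem spencer_apply_two (r p : ℕ) (h : r ≤ p + 1) (c : S.lie.Cochain S.W r (p + 1) 1)
    (a b : S.W) : S.lie.spencer S.W r p 1 h c ![a, b]
      = S.lie.coeffBracket S.W r p h b (c ![a]) - S.lie.coeffBracket S.W r p h a (c ![b]) := by
  change -(alternate (S.lie.coeffBracket S.W r p h) c ![a, b]) = _
  have e : ∀ X Y : S.lie.Coeff S.W r p, -((-1 : ℤ) ^ ((0 : Fin 2) : ℕ) • X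
      + (-1 : ℤ) ^ ((1 : Fin 2) : ℕ) • Y) = Y - X := by
    intro X Y
    simp [sub_eq_add_neg]
  rw [alternate_apply, Fin.sum_univ_two, e, (removeNth_two a b).1, (removeNth_two a b).2]
  rfl

theorem toCoeff_zero_injective (p : ℕ) : Function.Injective (S.lie.toCoeff S.W 0 p) := by
  rw [← LinearMap.ker_eq_bot]
  exact (Submodule.ker_mkQ _).trans (S.lie.levelSub_zero S.W p)

variable (S) in
/-- The graded piece of degree `p`, with its degree written as `p` and as `(p + 1) - 1`. -/
def pieceShift (p : ℕ) :
    S.lie.piece (p : ℤ) ≃ₗ[ℝ] S.lie.piece (((p + 1 : ℕ) : ℤ) - 1) :=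
  LinearEquiv.ofEq _ _ (congrArg S.lie.piece (by push_cast; ring))

theorem coe_pieceShift (p : ℕ) (X : S.lie.piece (p : ℤ)) : (S.pieceShift p X : 𝔥) = X := rfl

theorem FormFamily.curvature_congr {η η' : S.FormFamily M} {q : ℕ}
    (h : ∀ r : ℤ, r < q → η r = η' r) (x : M) : η.curvature q x = η'.curvature q x := by
  unfold FormFamily.curvature FormFamily.bracket
  rw [h _ (show (q : ℤ) - 1 < q by omega), h (-1) (by omega)]
  congr 3
  refine Finset.sum_congr rfl fun r hr => ?_
  rw [Finset.mem_range] at hr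
  rw [h r (by omega), h ((q : ℤ) - 1 - r) (by omega)]

theorem frameMap_eq {w : Fin n → S.W}
    (hw : ∀ i, S.coord (w i) = Sum.elim (Pi.single i (1 : ℝ)) fun _ => 0) {x : M}
    (u : Module.Basis (Fin n) ℝ (TangentSpace (𝓡 n) x)) (i : Fin n) :
    S.frameMap u (w i) = u i := by
  have h1 : (fun j => S.coord (w i) (Sum.inl j)) = Pi.single i 1 := by
    ext j
    rw [hw]
    rfl
  change u.equivFun.symm (fun j => S.coord (w i) (Sum.inl j)) = _
  rw [h1, Module.Basis.equivFun_symm_apply]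
  simp [Pi.single_apply]

variable [IsManifold (𝓡 n) ∞ M]
variable {G : Subgroup (Matrix.GeneralLinearGroup (Fin n) ℝ)} {P : GStructure G M}
  {U : Set M} {s : (x : M) → Module.Basis (Fin n) ℝ (TangentSpace (𝓡 n) x)} {η : S.FormFamily M}

/-- Forgetting the last form of an admissible tuple of order `p + 1`. -/
theorem IsAdmissible.of_succ {p : ℕ} (h : S.IsAdmissible P (p + 1) U s η) :
    S.IsAdmissible P p U s η where
  isOpen := h.isOpen
  isSection := h.isSection
  smooth r h1 h2 := h.smooth r h1 (by push_cast; omega)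
  soldering := h.soldering
  structure_eq q hq := h.structure_eq q (hq.trans p.lt_succ_self)

/-- The last form of an admissible tuple of order `p + 1` exhibits the curvature of the shortened
tuple as the coboundary of `-ωᵖ`. -/
theorem IsAdmissible.curvatureCochain_mem_coboundaries {p : ℕ}
    (h : S.IsAdmissible P (p + 1) U s η) {x : M} (hx : x ∈ U) :
    η.curvatureCochain 0 p (s x) ∈ S.lie.coboundaries S.W 0 p p.zero_le 2 := by
  let c : S.lie.Cochain S.W 0 (p + 1) 1 :=
    (S.lie.toCoeff S.W 0 (p + 1) ∘ₗ (S.pieceShift p).toLinearMap).compAlternatingMap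
      ((-(η (p : ℤ) x).toAlternatingMap).compLinearMap (S.frameMap (s x)))
  have hc : ∀ a, c ![a] = S.lie.toCoeff S.W 0 (p + 1)
      (S.pieceShift p (-(η (p : ℤ) x ![S.frameMap (s x) a]))) := by
    intro a
    rw [← comp_vec_one (S.frameMap (s x))]
    rfl
  refine ⟨c, ?_⟩
  ext v
  obtain ⟨a, b, rfl⟩ : ∃ a b, v = ![a, b] := ⟨v 0, v 1, by ext i; fin_cases i <;> rfl⟩
  rw [spencer_apply_two, hc, hc, S.lie.coeffBracket_toCoeff, S.lie.coeffBracket_toCoeff,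
    ← map_sub, curvatureCochain_apply_two]
  congr 1
  refine Subtype.ext ?_
  rw [h.structure_eq p p.lt_succ_self x hx, AlternatingMap.neg_apply, Submodule.coe_sub,
    Submodule.coe_neg, η.coe_bracket_apply (by ring), S.lie.coe_bracketRight,
    S.lie.coe_bracketRight, coe_pieceShift, coe_pieceShift, h.soldering_frameMap hx,
    h.soldering_frameMap hx, Submodule.coe_neg, Submodule.coe_neg,
    S.lie.bracket_swap ((b : S.lie.piece (-1)) : 𝔥),
    S.lie.bracket_swap ((a : S.lie.piece (-1)) : 𝔥)]
  simp only [map_neg, LinearMap.neg_apply]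
  abel

variable (S) in
/-- The Spencer operator on 1-cochains, in terms of the values on `w₁, …, wₙ`:
`X ↦ ([Xᵢ, wⱼ] - [Xⱼ, wᵢ])ᵢⱼ`. -/
def spencerMatrix (p : ℕ) (w : Fin n → S.W) :
    (Fin n → S.lie.piece (((p + 1 : ℕ) : ℤ) - 1)) →ₗ[ℝ]
      (Fin n → Fin n → S.lie.piece ((p : ℤ) - 1)) :=
  LinearMap.pi fun i => LinearMap.pi fun j =>
    S.lie.bracketRight S.W p (w j) ∘ₗ LinearMap.proj i
      - S.lie.bracketRight S.W p (w i) ∘ₗ LinearMap.proj j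

theorem coe_spencerMatrix (p : ℕ) (w : Fin n → S.W)
    (X : Fin n → S.lie.piece (((p + 1 : ℕ) : ℤ) - 1)) (i j : Fin n) :
    (S.spencerMatrix p w X i j : 𝔥)
      = S.lie.bracket (X i) (w j : S.lie.piece (-1))
        - S.lie.bracket (X j) (w i : S.lie.piece (-1)) := by
  rw [← S.lie.coe_bracketRight, ← S.lie.coe_bracketRight]
  rfl

/-- A linear map of vector spaces has a linear generalized inverse. -/
theorem exists_generalizedInverse {V V' : Type*} [AddCommGroup V] [Module ℝ V] [AddCommGroup V']
    [Module ℝ V'] (D : V →ₗ[ℝ] V') : ∃ L : V' →ₗ[ℝ] V, ∀ X, D (L (D X)) = D X := by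
  obtain ⟨g, hg⟩ := D.rangeRestrict.exists_rightInverse_of_surjective D.range_rangeRestrict
  obtain ⟨L, hL⟩ := LinearMap.exists_extend g
  refine ⟨L, fun X => ?_⟩
  have h1 : L (D X) = g (D.rangeRestrict X) := congrArg (fun f => f (D.rangeRestrict X)) hL
  rw [h1]
  exact congrArg (fun f => (f (D.rangeRestrict X) : V')) hg

/-- The components of the curvature in the frame `s`. -/
def curvatureMatrix (η : S.FormFamily M) (p : ℕ)
    (s : (x : M) → Module.Basis (Fin n) ℝ (TangentSpace (𝓡 n) x)) (x : M) :
    Fin n → Fin n → S.lie.piece ((p : ℤ) - 1) :=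
  fun i j => η.curvature p x ![s x i, s x j]

section Frame

variable {w : Fin n → S.W}
  (hw : ∀ i, S.coord (w i) = Sum.elim (Pi.single i (1 : ℝ)) fun _ => 0)
include hw

theorem IsAdmissible.soldering_frame {p : ℕ} (h : S.IsAdmissible P p U s η) {x : M} (hx : x ∈ U)
    (i : Fin n) : η (-1) x ![s x i] = w i := by
  rw [← h.soldering_frameMap hx (w i), frameMap_eq hw]

omit [IsManifold (𝓡 n) ∞ M] in
theorem curvatureMatrix_mem_range {p : ℕ} {x : M}
    (hb : η.curvatureCochain 0 p (s x) ∈ S.lie.coboundaries S.W 0 p p.zero_le 2) :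
    ∃ X, curvatureMatrix η p s x = S.spencerMatrix p w X := by
  obtain ⟨c, hc⟩ := hb
  have hX : ∀ i, ∃ X, S.lie.toCoeff S.W 0 (p + 1) X = c ![w i] :=
    fun i => Submodule.mkQ_surjective _ _
  choose X hX using hX
  refine ⟨X, ?_⟩
  ext i j : 2
  refine toCoeff_zero_injective p ?_
  have h1 : S.lie.spencer S.W 0 p 1 _ c ![w i, w j]
      = η.curvatureCochain 0 p (s x) ![w i, w j] := congrArg (fun f => f ![w i, w j]) hc
  rw [spencer_apply_two, curvatureCochain_apply_two, frameMap_eq hw, frameMap_eq hw, ← hX, ← hX,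
    S.lie.coeffBracket_toCoeff, S.lie.coeffBracket_toCoeff, ← map_sub] at h1
  exact h1.symm

end Frame

/-- The map `𝔥⁻¹ → 𝔥ᵖ` that sends the `i`-th coordinate vector of `W` to `-Xᵢ`. -/
def potential (p : ℕ) (X : Fin n → S.lie.piece (((p + 1 : ℕ) : ℤ) - 1)) :
    S.lie.piece (-1) →L[ℝ] S.lie.piece (p : ℤ) :=
  have := S.finiteDimensional
  LinearMap.toContinuousLinearMap
    (-∑ i, (LinearMap.proj (Sum.inl i) ∘ₗ S.coord).smulRight ((S.pieceShift p).symm (X i)))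

theorem potential_apply (p : ℕ) (X : Fin n → S.lie.piece (((p + 1 : ℕ) : ℤ) - 1))
    (Y : S.lie.piece (-1)) :
    potential p X Y = -∑ i, S.coord Y (Sum.inl i) • (S.pieceShift p).symm (X i) := by
  change (-∑ i, (LinearMap.proj (Sum.inl i) ∘ₗ S.coord).smulRight ((S.pieceShift p).symm (X i)) :
    S.lie.piece (-1) →ₗ[ℝ] S.lie.piece (p : ℤ)) Y = _
  rw [LinearMap.neg_apply, LinearMap.sum_apply]
  rfl

/-- The family `η` with `ωᵖ` replaced by the form that a linear choice `L` of primitives assigns to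
the curvature of order `p + 1`. -/
def extendFamily (η : S.FormFamily M) (p : ℕ)
    (s : (x : M) → Module.Basis (Fin n) ℝ (TangentSpace (𝓡 n) x))
    (L : (Fin n → Fin n → S.lie.piece ((p : ℤ) - 1)) →ₗ[ℝ]
      (Fin n → S.lie.piece (((p + 1 : ℕ) : ℤ) - 1))) : S.FormFamily M :=
  Function.update η (p : ℤ) fun x =>
    (potential p (L (curvatureMatrix η p s x))).compContinuousAlternatingMap (η (-1) x)

/-- The components of the curvature in a smooth frame are smooth. -/
theorem IsAdmissible.contDiffOn_curvatureMatrix {p : ℕ} (h : S.IsAdmissible P p U s η) (x₀ : M) :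
    ContDiffOn ℝ ∞ (fun y => curvatureMatrix η p s ((extChartAt (𝓡 n) x₀).symm y))
      (chartDomain x₀ U) := by
  have := S.finiteDimensional
  refine contDiffOn_pi.2 fun i => contDiffOn_pi.2 fun j => ?_
  let V : Fin n → EuclideanSpace ℝ (Fin n) → EuclideanSpace ℝ (Fin n) := fun i y =>
    mfderiv (𝓡 n) 𝓘(ℝ, EuclideanSpace ℝ (Fin n)) (extChartAt (𝓡 n) x₀)
      ((extChartAt (𝓡 n) x₀).symm y) (s ((extChartAt (𝓡 n) x₀).symm y) i)
  have hV : ∀ i, ContDiffOn ℝ ∞ (V i) (chartDomain x₀ U) :=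
    fun i => contDiffOn_vectorField_inChart h.isOpen (h.isSection.2 i) x₀
  have hVs : ∀ i, ∀ y ∈ chartDomain x₀ U,
      chartVec x₀ y (V i y) = s ((extChartAt (𝓡 n) x₀).symm y) i :=
    fun i y hy => mfderiv_extChartAt_symm_mfderiv_extChartAt hy.1 _
  have hη : ∀ r : ℤ, -1 ≤ r → r ≤ (p : ℤ) - 1 → ∀ i, ContDiffOn ℝ ∞
      (fun y => ((η r).inChart x₀ y ![V i y] : 𝔥)) (chartDomain x₀ U) := fun r h1 h2 i =>
    (S.lie.piece r).subtypeL.contDiff.comp_contDiffOn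
      ((h.smooth r h1 h2 x₀).alternating_one_apply (hV i))
  have hO := isOpen_chartDomain (n := n) x₀ h.isOpen
  have hd : ContDiffOn ℝ ∞ (fun y =>
      (extDeriv ((η ((p : ℤ) - 1)).inChart x₀) y ![V i y, V j y] : 𝔥)) (chartDomain x₀ U) :=
    (S.lie.piece _).subtypeL.contDiff.comp_contDiffOn
      (((h.smooth ((p : ℤ) - 1) (by omega) le_rfl x₀).extDeriv hO).alternating_two_apply
        (hV i) (hV j))
  have hsum : ContDiffOn ℝ ∞ (fun y => ∑ r ∈ Finset.range p, S.bracketCLM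
      ((η ((p : ℤ) - 1 - r)).inChart x₀ y ![V i y]) ((η (r : ℤ)).inChart x₀ y ![V j y]))
      (chartDomain x₀ U) := by
    refine ContDiffOn.sum fun r hr => ?_
    rw [Finset.mem_range] at hr
    exact (S.bracketCLM.contDiff.comp_contDiffOn (hη _ (by omega) (by omega) i)).clm_apply
      (hη _ (by omega) (by omega) j)
  let π : 𝔥 →L[ℝ] S.lie.piece ((p : ℤ) - 1) :=
    LinearMap.toContinuousLinearMap (S.lie.proj ((p : ℤ) - 1))
  refine (π.contDiff.comp_contDiffOn (hd.add hsum)).congr fun y hy => ?_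
  have h1 : (curvatureMatrix η p s ((extChartAt (𝓡 n) x₀).symm y) i j : 𝔥)
      = extDeriv ((η ((p : ℤ) - 1)).inChart x₀) y ![V i y, V j y]
        + ∑ r ∈ Finset.range p, S.bracketCLM
      ((η ((p : ℤ) - 1 - r)).inChart x₀ y ![V i y]) ((η (r : ℤ)).inChart x₀ y ![V j y]) := by
    rw [curvatureMatrix, η.curvature_apply,
      ← DiffForm.extDer_inChart h.isOpen (h.smooth _ (by omega) le_rfl) x₀ hy,
      inChart_apply_two, hVs i y hy, hVs j y hy]
    congr 1
    refine Finset.sum_congr rfl fun r _ => ?_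
    rw [inChart_apply_one, inChart_apply_one, hVs i y hy, hVs j y hy, S.bracketCLM_apply]
  refine Subtype.ext ?_
  rw [← S.lie.coe_proj_of_mem (Subtype.coe_prop (curvatureMatrix η p s _ i j)), h1]
  rfl

theorem IsAdmissible.smoothOn_extendFamily {p : ℕ} (h : S.IsAdmissible P p U s η)
    (L : (Fin n → Fin n → S.lie.piece ((p : ℤ) - 1)) →ₗ[ℝ]
      (Fin n → S.lie.piece (((p + 1 : ℕ) : ℤ) - 1))) :
    (extendFamily η p s L (p : ℤ)).SmoothOn U := by
  have := S.finiteDimensional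
  intro x₀
  refine contDiffOn_alternating_one fun v => ?_
  have h1 : ContDiffOn ℝ ∞ (fun y => (η (-1)).inChart x₀ y ![v]) (chartDomain x₀ U) :=
    (h.smooth (-1) le_rfl (by omega) x₀).alternating_one_apply contDiffOn_const
  have h2 : ∀ i, ContDiffOn ℝ ∞ (fun y => (S.pieceShift p).symm
      (L (curvatureMatrix η p s ((extChartAt (𝓡 n) x₀).symm y)) i)) (chartDomain x₀ U) := fun i =>
    (LinearMap.toContinuousLinearMap ((S.pieceShift p).symm.toLinearMap ∘ₗ
      LinearMap.proj (φ := fun _ : Fin n => S.lie.piece (((p + 1 : ℕ) : ℤ) - 1)) i ∘ₗ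
        L)).contDiff.comp_contDiffOn (h.contDiffOn_curvatureMatrix x₀)
  have h3 : ∀ i, ContDiffOn ℝ ∞ (fun y => S.coord ((η (-1)).inChart x₀ y ![v]) (Sum.inl i))
      (chartDomain x₀ U) := fun i =>
    (LinearMap.toContinuousLinearMap
      (LinearMap.proj (φ := fun _ : Fin n ⊕ Fin m => ℝ) (Sum.inl i) ∘ₗ
        S.coord)).contDiff.comp_contDiffOn h1
  refine (ContDiffOn.sum (s := Finset.univ) fun i _ => (h3 i).smul (h2 i)).neg.congr fun y hy => ?_
  rw [extendFamily, inChart_apply_one, Function.update_self]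
  refine (potential_apply p _ (η (-1) _ ![chartVec x₀ y v])).trans ?_
  rw [← inChart_apply_one]
  rfl

/-- If the curvature is a coboundary at each point of `U`, then the tuple extends to an admissible
tuple of order `p + 1` on `U`. -/
theorem IsAdmissible.exists_succ {p : ℕ} (h : S.IsAdmissible P p U s η) {x₀ : M} (hx₀ : x₀ ∈ U)
    (hb : ∀ x ∈ U, η.curvatureCochain 0 p (s x) ∈ S.lie.coboundaries S.W 0 p p.zero_le 2) :
    ∃ η' : S.FormFamily M, S.IsAdmissible P (p + 1) U s η' := by
  have hco : ∀ i, S.coord (η (-1) x₀ ![s x₀ i]) = Sum.elim (Pi.single i (1 : ℝ)) fun _ => 0 := by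
    intro i
    rw [h.soldering x₀ hx₀]
    congr 1
    ext j
    rw [Module.Basis.repr_self, Finsupp.single_eq_pi_single]
  -- The coordinate vectors of `W`, seen through the soldering form at one point.
  let w : Fin n → S.W := fun i => ⟨η (-1) x₀ ![s x₀ i], fun j => by rw [hco]; rfl⟩
  have hw : ∀ i, S.coord (w i) = Sum.elim (Pi.single i (1 : ℝ)) fun _ => 0 := hco
  obtain ⟨L, hL⟩ := exists_generalizedInverse (S.spencerMatrix p w)
  have hne : ∀ r : ℤ, r < p → extendFamily η p s L r = η r :=
    fun r hr => Function.update_of_ne hr.ne _ _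
  refine ⟨extendFamily η p s L, h.isOpen, h.isSection, fun r h1 h2 => ?_, fun x hx v => ?_,
    fun q hq x hx => ?_⟩
  · by_cases hr : r = p
    · subst hr
      exact h.smoothOn_extendFamily L
    · rw [hne r (by push_cast at h2; omega)]
      exact h.smooth r h1 (by push_cast at h2; omega)
  · rw [hne (-1) (by omega)]
    exact h.soldering x hx v
  · rw [FormFamily.curvature_congr (η' := η) fun r hr => hne r (by omega)]
    by_cases hqp : q < p
    · rw [h.structure_eq q hqp x hx]
      unfold FormFamily.bracket
      rw [hne (-1) (by omega), hne q (by omega)]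
    · -- The new equation `Ω^{p-1} = -[ω⁻¹, ωᵖ]`, checked on the frame `s`.
      obtain rfl : q = p := by omega
      obtain ⟨X, hX⟩ := curvatureMatrix_mem_range hw (hb x hx)
      have hval : ∀ i, (extendFamily η q s L (q : ℤ) x ![s x i] : 𝔥)
          = -(L (curvatureMatrix η q s x) i : 𝔥) := by
        intro i
        have h1 : extendFamily η q s L (q : ℤ) x ![s x i]
            = potential q (L (curvatureMatrix η q s x)) (η (-1) x ![s x i]) := by
          rw [extendFamily, Function.update_self]
          rfl
        rw [h1, h.soldering_frame hw hx, potential_apply, hw]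
        simp [Pi.single_apply]
        rfl
      refine Module.Basis.ext_alternating (s x) fun v _ => ?_
      have hv : (fun i => s x (v i)) = ![s x (v 0), s x (v 1)] := by
        ext i
        fin_cases i <;> rfl
      rw [hv]
      refine Subtype.ext ?_
      rw [AlternatingMap.neg_apply, Submodule.coe_neg, FormFamily.coe_bracket_apply _ (by ring),
        hval, hval, hne (-1) (by omega), h.soldering_frame hw hx, h.soldering_frame hw hx]
      have h2 := coe_spencerMatrix q w (L (curvatureMatrix η q s x)) (v 0) (v 1)
      have h3 : S.spencerMatrix q w (L (curvatureMatrix η q s x)) = curvatureMatrix η q s x := by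
        rw [hX, hL]
      rw [h3] at h2
      refine h2.trans ?_
      rw [S.lie.bracket_swap (L _ (v 0) : 𝔥), S.lie.bracket_swap (L _ (v 1) : 𝔥)]
      simp only [map_neg]
      abel

end Extension

end FlatReductive

end Homogeneous

end

/-! ### Curvature cocycles and the obstruction to higher immersibility -/

theorem theorem3p4 {n m k : ℕ}
    {𝔥 : Type*} [NormedAddCommGroup 𝔥] [NormedSpace ℝ 𝔥]
    {E : Type*} [NormedAddCommGroup E] [NormedSpace ℝ E] [FiniteDimensional ℝ E]
    {H : Type*} [TopologicalSpace H] [ChartedSpace E H] [Group H] [LieGroup 𝓘(ℝ, E) ∞ H]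
    {N : Type*} [TopologicalSpace N] [ChartedSpace (EuclideanSpace ℝ (Fin (n + m))) N]
    [IsManifold (𝓡 (n + m)) ∞ N] [MulAction H N] [ContMDiffSMul 𝓘(ℝ, E) (𝓡 (n + m)) ∞ H N]
    (S : FlatReductive n m k 𝔥 E H N)
    {M : Type*} [TopologicalSpace M] [ChartedSpace (EuclideanSpace ℝ (Fin n)) M]
    [IsManifold (𝓡 n) ∞ M]
    {G : Subgroup (Matrix.GeneralLinearGroup (Fin n) ℝ)} (P : GStructure G M)
    (_hG : Nonempty (G ≃* S.gSharp ⧸ S.nSharp))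
    (p : ℕ) (_hP : S.LocallyImmersible P p) :
    (∀ (U : Set M) (s : (x : M) → Module.Basis (Fin n) ℝ (TangentSpace (𝓡 n) x))
      (η : S.FormFamily M), S.IsAdmissible P p U s η → ∀ x ∈ U,
        η.curvatureCochain 0 p (s x) ∈ S.lie.cocycles S.W 0 p p.zero_le 2 ∧
        ∀ (r : ℕ) (hr : r ≤ p), 1 ≤ r →
          η.curvatureCochain r p (s x) ∈ S.lie.cocycles S.W r p hr 2) ∧
    (S.LocallyImmersible P (p + 1) ↔
      ∀ x₀ : M, ∃ (U : Set M) (s : (x : M) → Module.Basis (Fin n) ℝ (TangentSpace (𝓡 n) x))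
        (η : S.FormFamily M), S.IsAdmissible P p U s η ∧ x₀ ∈ U ∧
          ∀ x ∈ U, ∃ hz : η.curvatureCochain 0 p (s x) ∈ S.lie.cocycles S.W 0 p p.zero_le 2,
            (Submodule.Quotient.mk ⟨η.curvatureCochain 0 p (s x), hz⟩ :
              S.lie.Cohomology S.W 0 p p.zero_le 2) = 0) := by
  have hmem : ∀ {c : S.lie.Cochain S.W 0 p 2} (hz : c ∈ S.lie.cocycles S.W 0 p p.zero_le 2),
      (Submodule.Quotient.mk ⟨c, hz⟩ : S.lie.Cohomology S.W 0 p p.zero_le 2) = 0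
        ↔ c ∈ S.lie.coboundaries S.W 0 p p.zero_le 2 := fun hz => by
    rw [Submodule.Quotient.mk_eq_zero]
    rfl
  refine ⟨fun U s η h x hx => ⟨h.curvatureCochain_mem_cocycles hx 0 p.zero_le,
    fun r hr _ => h.curvatureCochain_mem_cocycles hx r hr⟩, fun hsucc x₀ => ?_, fun hex x₀ => ?_⟩
  · obtain ⟨U, s, η, h, hx₀⟩ := hsucc x₀
    exact ⟨U, s, η, h.of_succ, hx₀, fun x hx =>
      ⟨h.of_succ.curvatureCochain_mem_cocycles hx 0 p.zero_le,
        (hmem _).2 (h.curvatureCochain_mem_coboundaries hx)⟩⟩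
  · obtain ⟨U, s, η, h, hx₀, hcoh⟩ := hex x₀
    obtain ⟨η', h'⟩ := h.exists_succ hx₀ fun x hx => by
      obtain ⟨hz, h0⟩ := hcoh x hx
      exact (hmem hz).1 h0
    exact ⟨U, s, η', h', hx₀⟩
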